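/- Let $\mathbb{D}$ be the open unit disk in $\mathbb{C}$. A horodisk is an open Euclidean disk properly contained in $\mathbb{D}$ whose boundary circle is tangent to $\partial\mathbb{D}$. A nonempty connected open set $G\subsetneq\mathbb{D}$ is called horo-convex if for every $\omega\in\mathbb{D}\cap\partial G$ there is a horodisk $H$ with $\omega\in\partial H$ and $G\cap H=\emptyset$. A horo-crescent is a set of the form $\mathbb{D}\setminus\overline{H}$ with $H$ a horodisk. Let $\lambda_{\mathbb{D}}(z)=1/(1-|z|^2)$. For a proper subdomain $G$ of $\mathbb{D}$ let $\lambda_G$ be its hyperbolic metric, determined by $\lambda_G(p(\zeta))\,|p'(\zeta)|=\lambda_{\mathbb{D}}(\zeta)$ for $\zeta\in\mathbb{D}$, where $p:\mathbb{D}\to G$ is any holomorphic covering (if $G$ is simply connected, any conformal map of $\mathbb{D}$ onto $G$), and let $\nu_G(z)=\lambda_G(z)/\lambda_{\mathbb{D}}(z)=(1-|z|^2)\lambda_G(z)$ be its hyperbolic density. Let $d_{\mathbb{D}}(z,w)=\operatorname{arctanh}\left|\frac{z-w}{1-\bar z w}\right|$ be the hyperbolic distance in $\mathbb{D}$, and let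 $d_G(z)=\inf\{d_{\mathbb{D}}(z,w): w\in\mathbb{D}\cap\partial G\}$. **Theorem.** Let $G$ be a horo-convex domain. Then, for each $z\in G$, $$\nu_G(z)\ \geq\ \frac{\pi}{e^{2d_G(z)}}\,\frac{1}{\sin\dfrac{\pi}{e^{2d_G(z)}}},$$ and, for each $z\in G$, equality holds at $z$ if and only if $G$ is a horo-crescent. (So equality holds at one point of $G$ if and only if it holds at every point of $G$, if and only if $G$ is a horo-crescent.) -/

import Mathlib

open Metric Set

noncomputable section

namespace HoroConvex

/-- A horodisk of the unit disk: an open Euclidean disk contained in the unit disk, different from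
it, whose boundary circle (a horocycle) is tangent to the unit circle, at the point `ζ`. -/
def IsHorodisk (H : Set ℂ) : Prop :=
  ∃ (ζ : ℂ) (r : ℝ), ‖ζ‖ = 1 ∧ 0 < r ∧ r < 1 ∧ H = ball ((1 - r : ℝ) * ζ) r

/-- A horocyclically convex domain: a nonempty connected open proper subset `G` of the unit disk
such that through every boundary point of `G` in the unit disk there passes a horocycle whose
horodisk does not meet `G`. -/
structure IsHoroConvex (G : Set ℂ) : Prop where
  isOpen : IsOpen G
  isConnected : IsConnected G
  ssubset_disk : G ⊂ ball (0 : ℂ) 1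
  exists_horodisk : ∀ ω ∈ ball (0 : ℂ) 1 ∩ frontier G,
    ∃ H : Set ℂ, IsHorodisk H ∧ ω ∈ frontier H ∧ G ∩ H = ∅

/-- A horo-crescent: the complement in the unit disk of a closed horodisk. -/
def IsHoroCrescent (G : Set ℂ) : Prop :=
  ∃ H : Set ℂ, IsHorodisk H ∧ G = ball (0 : ℂ) 1 \ closure H

/-- The pseudo-hyperbolic distance of the unit disk. -/
def pseudoHypDist (z w : ℂ) : ℝ :=
  ‖(z - w) / (1 - (starRingEnd ℂ) z * w)‖

/-- The hyperbolic distance of the unit disk (Gaussian curvature `-4`). -/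
def hypDist (z w : ℂ) : ℝ :=
  Real.artanh (pseudoHypDist z w)

/-- The hyperbolic distance from `z` to the boundary of `G`. Only the boundary points in the unit
disk count, those on the unit circle being at infinite hyperbolic distance. For a proper subdomain
of the unit disk there are such points. -/
def hypDistBoundary (G : Set ℂ) (z : ℂ) : ℝ :=
  sInf (hypDist z '' (ball (0 : ℂ) 1 ∩ frontier G))

/-- The hyperbolic metric of the unit disk (Gaussian curvature `-4`). -/
def diskMetric (z : ℂ) : ℝ :=
  1 / (1 - ‖z‖ ^ 2)

/-- `p` is a holomorphic covering of `G` by the unit disk. Values of `p` outside of the unit disk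
do not matter. -/
structure IsHolomorphicCovering (p : ℂ → ℂ) (G : Set ℂ) : Prop where
  differentiableOn : DifferentiableOn ℂ p (ball 0 1)
  image_eq : p '' ball 0 1 = G
  isCoveringMapOn : IsCoveringMapOn (fun z : ball (0 : ℂ) 1 => p z) G

/-- `t` is the value at `w` of the push-forward to `G` of the hyperbolic metric of the unit disk
under some holomorphic covering. -/
def IsHypMetricAt (G : Set ℂ) (w : ℂ) (t : ℝ) : Prop :=
  ∃ (p : ℂ → ℂ) (z : ℂ), IsHolomorphicCovering p G ∧ z ∈ ball (0 : ℂ) 1 ∧ p z = w ∧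
    t * ‖deriv p z‖ = diskMetric z

open Classical in
/-- The hyperbolic metric (Gaussian curvature `-4`) of a plane domain `G`, that is, the metric
density `λ` on `G` with `λ (p z) * |p' z| = 1 / (1 - |z| ^ 2)` for the holomorphic coverings `p` of
`G` by the unit disk. It depends neither on the covering nor on the preimage `z`. If `G` is simply
connected, the coverings are the conformal maps of the unit disk onto `G`. -/
def hypMetric (G : Set ℂ) (w : ℂ) : ℝ :=
  if h : ∃ t : ℝ, IsHypMetricAt G w t then h.choose else 0

/-- The hyperbolic density of `G` relative to the unit disk. -/
def hypDensity (G : Set ℂ) (z : ℂ) : ℝ :=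
  hypMetric G z / diskMetric z

end HoroConvex

end

/-!
The bound is monotonicity of the hyperbolic metric, applied to a horo-crescent. Let `ω` be a point of
the boundary of `G` in the disk that is nearest to `z`, and let `H` be a horodisk at `ω` off `G`.
Then `G` lies in the horo-crescent `C` that is the complement of `closure H`. The Cayley transform
that takes the point of tangency of `H` to infinity maps the disk to the right half-plane and `C` to
a strip `0 < re u < k`, so `C` has an explicit conformal map `f` onto the disk with `f z = 0`, and
`‖f' z‖ (1 - ‖z‖ ^ 2) = x / sin x` with `x = π * re (cayley z) / k`
(`exists_bijOn_ball_horoCrescent`). In the half-plane, the distance from `z` to `ω` is at least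
`log (k / re (cayley z)) / 2` (`cayley_re_div_le_exp`), and `x / sin x` is increasing. For a covering
`p` of `G`, the Schwarz–Pick lemma for `f ∘ p` gives the inequality; in the case of equality `f ∘ p`
is onto, so that `G = C` (`IsHypMetricAt.norm_deriv_le`). If conversely `G` is a horo-crescent, its
conformal map lifts through any covering, so that every covering computes the same metric
(`IsHypMetricAt.eq_norm_deriv`), and the distance of `z` to the boundary is known
(`exp_two_mul_hypDistBoundary_horoCrescent`).

What remains is that `G` has a holomorphic covering by the disk at all, without which `hypMetric G`
would be a junk value. A conformal map is found by the Riemann mapping theorem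
(`exists_bijOn_ball`), whose proof by an extremal problem needs square roots of non-vanishing
holomorphic functions only. These come from primitives, and simple connectivity enters as follows.
A point `a` off `G` can be joined to the unit circle off `G` by segments, the last one in a closed
horodisk, and this provides a primitive of `(w - a)⁻¹` on `G` (`IsHoroConvex.isExactOn_inv_sub`). The
Cauchy–Pompeiu formula writes every holomorphic function, on a relatively compact subset `V` of `G`,
as a superposition of such kernels with poles `a` whose kernels have primitives on `V`, and the
primitives are integrated (`isExactOn_of_closure_subset`) and glued (`isExactOn_of_forall_notMem`).
-/

noncomputable section

namespace HoroConvex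

/-! ### Automorphisms of the disk, the Schwarz–Pick lemma and injective holomorphic maps -/

section

open Filter Topology

/-- The automorphism of the unit disk that takes `a` to `0`. -/
def diskAut (a z : ℂ) : ℂ := (z - a) / (1 - (starRingEnd ℂ) a * z)

lemma one_sub_conj_mul_ne_zero {a z : ℂ} (ha : ‖a‖ < 1) (hz : ‖z‖ ≤ 1) :
    1 - (starRingEnd ℂ) a * z ≠ 0 := by
  intro h
  have h1 : (starRingEnd ℂ) a * z = 1 := by linear_combination -h
  have h2 : ‖a‖ * ‖z‖ = 1 := by
    simpa using congrArg norm h1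
  nlinarith [norm_nonneg a, norm_nonneg z]

lemma norm_one_sub_conj_mul_sq_sub (a z : ℂ) :
    ‖1 - (starRingEnd ℂ) a * z‖ ^ 2 - ‖z - a‖ ^ 2 = (1 - ‖a‖ ^ 2) * (1 - ‖z‖ ^ 2) := by
  simp only [← Complex.normSq_eq_norm_sq, Complex.normSq_apply]
  simp
  ring

lemma norm_diskAut_lt_one {a z : ℂ} (ha : ‖a‖ < 1) (hz : ‖z‖ < 1) : ‖diskAut a z‖ < 1 := by
  have h0 := one_sub_conj_mul_ne_zero ha hz.le
  rw [diskAut, norm_div, div_lt_one (norm_pos_iff.2 h0)]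
  have h := norm_one_sub_conj_mul_sq_sub a z
  have h1 : 0 < (1 - ‖a‖ ^ 2) * (1 - ‖z‖ ^ 2) := by
    apply mul_pos <;> nlinarith [norm_nonneg a, norm_nonneg z]
  exact lt_of_pow_lt_pow_left₀ 2 (norm_nonneg _) (by linarith)

lemma diskAut_mapsTo {a : ℂ} (ha : ‖a‖ < 1) : MapsTo (diskAut a) (ball 0 1) (ball 0 1) := by
  intro z hz
  rw [mem_ball_zero_iff] at hz ⊢
  exact norm_diskAut_lt_one ha hz

@[simp] lemma diskAut_self (a : ℂ) : diskAut a a = 0 := by simp [diskAut]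

lemma diskAut_neg_diskAut {a z : ℂ} (ha : ‖a‖ < 1) (hz : ‖z‖ < 1) :
    diskAut (-a) (diskAut a z) = z := by
  have h0 := one_sub_conj_mul_ne_zero ha hz.le
  have h1 := one_sub_conj_mul_ne_zero ha ha.le
  have h2 : 1 - (starRingEnd ℂ) (-a) * diskAut a z
      = (1 - (starRingEnd ℂ) a * a) / (1 - (starRingEnd ℂ) a * z) := by
    rw [diskAut, map_neg]; field_simp; ring
  rw [diskAut, h2, div_eq_iff (div_ne_zero h1 h0), diskAut, sub_neg_eq_add, div_add' _ _ _ h0,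
    mul_div_assoc']
  congr 1
  ring

lemma diskAut_diskAut_neg {a z : ℂ} (ha : ‖a‖ < 1) (hz : ‖z‖ < 1) :
    diskAut a (diskAut (-a) z) = z := by
  simpa using diskAut_neg_diskAut (a := -a) (by simpa) hz

lemma diskAut_zero (a : ℂ) : diskAut a 0 = -a := by simp [diskAut]

lemma diskAut_injOn {a : ℂ} (ha : ‖a‖ < 1) : InjOn (diskAut a) (ball 0 1) := by
  intro z hz w hw h
  rw [mem_ball_zero_iff] at hz hw
  rw [← diskAut_neg_diskAut ha hz, h, diskAut_neg_diskAut ha hw]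

lemma hasDerivAt_diskAut {a z : ℂ} (ha : ‖a‖ < 1) (hz : ‖z‖ < 1) :
    HasDerivAt (diskAut a) ((1 - ‖a‖ ^ 2 : ℝ) / (1 - (starRingEnd ℂ) a * z) ^ 2) z := by
  have h0 := one_sub_conj_mul_ne_zero ha hz.le
  have h := ((hasDerivAt_id z).sub_const a).div
    (((hasDerivAt_id z).const_mul ((starRingEnd ℂ) a)).const_sub 1) h0
  refine h.congr_deriv ?_
  have : ((1 - ‖a‖ ^ 2 : ℝ) : ℂ) = 1 - (starRingEnd ℂ) a * a := by
    rw [Complex.conj_mul']; push_cast; rfl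
  rw [this]
  simp only [id]
  congr 1
  ring

lemma differentiableOn_diskAut {a : ℂ} (ha : ‖a‖ < 1) :
    DifferentiableOn ℂ (diskAut a) (ball 0 1) := fun z hz =>
  (hasDerivAt_diskAut ha (by simpa using hz)).differentiableAt.differentiableWithinAt

lemma hasDerivAt_diskAut_zero {a : ℂ} (ha : ‖a‖ < 1) :
    HasDerivAt (diskAut a) ((1 - ‖a‖ ^ 2 : ℝ) : ℂ) 0 := by
  simpa using hasDerivAt_diskAut ha (z := 0) (by simp)

/-- The Schwarz–Pick lemma at a zero of `g`, with its equality case. -/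
lemma norm_deriv_mul_le_one {g : ℂ → ℂ} {a : ℂ} (hg : DifferentiableOn ℂ g (ball 0 1))
    (hm : MapsTo g (ball 0 1) (ball 0 1)) (ha : a ∈ ball (0 : ℂ) 1) (hga : g a = 0) :
    ‖deriv g a‖ * (1 - ‖a‖ ^ 2) ≤ 1 ∧
      (‖deriv g a‖ * (1 - ‖a‖ ^ 2) = 1 → BijOn g (ball 0 1) (ball 0 1)) := by
  have ha' : ‖a‖ < 1 := by simpa using ha
  have hna : ‖-a‖ < 1 := by simpa using ha'
  set φ := diskAut (-a)
  have hφm : MapsTo φ (ball 0 1) (ball 0 1) := diskAut_mapsTo hna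
  have hφ0 : φ 0 = a := by simp [φ, diskAut_zero]
  have hd : DifferentiableOn ℂ (g ∘ φ) (ball 0 1) :=
    hg.comp (differentiableOn_diskAut hna) hφm
  have h0 : (g ∘ φ) 0 = 0 := by simp [hφ0, hga]
  have hmm : MapsTo (g ∘ φ) (ball 0 1) (closedBall ((g ∘ φ) 0) 1) := by
    rw [h0]
    exact (hm.comp hφm).mono_right ball_subset_closedBall
  have hder : deriv (g ∘ φ) 0 = deriv g a * ((1 - ‖a‖ ^ 2 : ℝ) : ℂ) := by
    have h1 : HasDerivAt g (deriv g a) (φ 0) := by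
      rw [hφ0]; exact (hg.differentiableAt (isOpen_ball.mem_nhds ha)).hasDerivAt
    have h2 := hasDerivAt_diskAut_zero hna
    rw [norm_neg] at h2
    exact (h1.comp 0 h2).deriv
  have hpos : 0 < 1 - ‖a‖ ^ 2 := by nlinarith [norm_nonneg a]
  have hnorm : ‖deriv (g ∘ φ) 0‖ = ‖deriv g a‖ * (1 - ‖a‖ ^ 2) := by
    rw [hder, norm_mul, Complex.norm_real, Real.norm_of_nonneg hpos.le]
  rw [← hnorm]
  refine ⟨Complex.norm_deriv_le_one_of_mapsTo_ball hd hmm one_pos, fun h => ?_⟩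
  have haff := Complex.affine_of_mapsTo_ball_of_norm_dslope_eq_div hd hmm
    (mem_ball_self one_pos) (by simpa using h)
  rw [dslope_same, h0] at haff
  set c := deriv (g ∘ φ) 0
  have hc : c ≠ 0 := by rw [← norm_pos_iff, h]; exact one_pos
  have hval : ∀ z ∈ ball (0 : ℂ) 1, g z = diskAut a z * c := by
    intro z hz
    have := haff (diskAut_mapsTo ha' hz)
    simpa [φ, diskAut_neg_diskAut ha' (by simpa using hz : ‖z‖ < 1)] using this
  refine ⟨hm, fun z hz w hw hzw => ?_, fun w hw => ?_⟩
  · rw [hval z hz, hval w hw] at hzw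
    exact diskAut_injOn ha' hz hw (mul_right_cancel₀ hc hzw)
  · have hwc : w / c ∈ ball (0 : ℂ) 1 := by
      simpa [h] using hw
    refine ⟨φ (w / c), hφm hwc, ?_⟩
    rw [hval _ (hφm hwc), diskAut_diskAut_neg ha' (by simpa using hwc), div_mul_cancel₀ _ hc]

section Injective

variable {U : Set ℂ} {f : ℂ → ℂ}

/-- The open mapping theorem: an injective function is not locally constant. -/
lemma nhds_le_map_of_injOn (hU : IsOpen U) (hf : DifferentiableOn ℂ f U) (hi : InjOn f U)
    {z : ℂ} (hz : z ∈ U) : 𝓝 (f z) ≤ map f (𝓝 z) := by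
  refine ((hf.analyticOnNhd hU) z hz).eventually_constant_or_nhds_le_map_nhds.resolve_left ?_
  intro h
  obtain ⟨w, ⟨hw1, hw2⟩, hw3⟩ :=
    (((h.and (hU.mem_nhds hz)).filter_mono nhdsWithin_le_nhds).and
      (self_mem_nhdsWithin : {z}ᶜ ∈ 𝓝[≠] z)).exists
  exact hw3 (hi hw2 hz hw1)

lemma isOpen_image_of_injOn (hU : IsOpen U) (hf : DifferentiableOn ℂ f U) (hi : InjOn f U) :
    IsOpen (f '' U) := by
  rw [isOpen_iff_mem_nhds]
  rintro _ ⟨z, hz, rfl⟩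
  exact nhds_le_map_of_injOn hU hf hi hz (image_mem_map (hU.mem_nhds hz))

/-- The inverse of an injective holomorphic function is holomorphic: it is continuous by the open
mapping theorem, it is differentiable off the isolated critical values by the inverse function
theorem, and these are removable singularities. -/
lemma analyticAt_leftInverse_of_injOn (hU : IsOpen U) (hf : DifferentiableOn ℂ f U)
    (hi : InjOn f U) {g : ℂ → ℂ} (hg : ∀ z ∈ U, g (f z) = z) {z : ℂ} (hz : z ∈ U) :
    AnalyticAt ℂ g (f z) := by
  have hcont : ∀ z ∈ U, ContinuousAt g (f z) := by
    intro z hz N hN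
    rw [hg z hz] at hN
    have h1 := nhds_le_map_of_injOn hU hf hi hz (image_mem_map (inter_mem hN (hU.mem_nhds hz)))
    refine mem_map.2 (mem_of_superset h1 ?_)
    rintro _ ⟨w, ⟨hw1, hw2⟩, rfl⟩
    simpa [hg w hw2] using hw1
  have himg := isOpen_image_of_injOn hU hf hi
  have han := (hf.analyticOnNhd hU).deriv
  -- the critical points are isolated, `f` not being locally constant
  have hne : ∀ᶠ w in 𝓝[≠] z, deriv f w ≠ 0 := by
    refine (han z hz).eventually_eq_zero_or_eventually_ne_zero.resolve_left fun h => ?_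
    obtain ⟨ε, hε, hball⟩ := Metric.eventually_nhds_iff_ball.1 (h.and (hU.mem_nhds hz))
    have hconst : ∀ w ∈ ball z ε, f w = f z := fun w hw =>
      (convex_ball z ε).is_const_of_fderivWithin_eq_zero (𝕜 := ℂ)
        (fun v hv => (hf.differentiableAt (hU.mem_nhds (hball v hv).2)).differentiableWithinAt)
        (fun v hv => by
          rw [fderivWithin_of_isOpen isOpen_ball hv]
          ext; simp [(hball v hv).1]) hw (mem_ball_self hε)
    have hw : z + (ε / 2 : ℝ) ∈ ball z ε := by
      rw [mem_ball, dist_self_add_left, Complex.norm_real, Real.norm_of_nonneg] <;> linarith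
    have := hi (hball _ hw).2 hz (hconst _ hw)
    simp at this
    exact hε.ne' this
  refine Complex.analyticAt_of_differentiable_on_punctured_nhds_of_continuousAt ?_ (hcont z hz)
  have htend : Tendsto g (𝓝[≠] (f z)) (𝓝[≠] z) := by
    refine tendsto_nhdsWithin_iff.2 ⟨?_, ?_⟩
    · have := (hcont z hz).tendsto
      rw [hg z hz] at this
      exact this.mono_left nhdsWithin_le_nhds
    · filter_upwards [self_mem_nhdsWithin, nhdsWithin_le_nhds
        (himg.mem_nhds (mem_image_of_mem f hz))]
      rintro _ h1 ⟨w, hw, rfl⟩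
      rw [hg w hw]
      rintro rfl
      exact h1 rfl
  filter_upwards [htend.eventually hne, nhdsWithin_le_nhds
    (himg.mem_nhds (mem_image_of_mem f hz))]
  rintro _ h1 ⟨w, hw, rfl⟩
  have h2 : HasDerivAt f (deriv f (g (f w))) (g (f w)) := by
    rw [hg w hw]; exact (hf.differentiableAt (hU.mem_nhds hw)).hasDerivAt
  refine (HasDerivAt.of_local_left_inverse (hcont w hw) h2 h1 ?_).differentiableAt
  filter_upwards [himg.mem_nhds (mem_image_of_mem f hw)]
  rintro _ ⟨v, hv, rfl⟩
  rw [hg v hv]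

lemma deriv_mul_deriv_leftInverse (hU : IsOpen U) (hf : DifferentiableOn ℂ f U)
    (hi : InjOn f U) {g : ℂ → ℂ} (hg : ∀ z ∈ U, g (f z) = z) {z : ℂ} (hz : z ∈ U) :
    deriv g (f z) * deriv f z = 1 := by
  have h1 := (analyticAt_leftInverse_of_injOn hU hf hi hg hz).differentiableAt.hasDerivAt
  have h2 := (h1.comp z (hf.differentiableAt (hU.mem_nhds hz)).hasDerivAt)
  have h3 : HasDerivAt (g ∘ f) 1 z := by
    refine (hasDerivAt_id z).congr_of_eventuallyEq ?_
    filter_upwards [hU.mem_nhds hz] with w hw using hg w hw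
  exact h2.unique h3

lemma deriv_ne_zero_of_injOn (hU : IsOpen U) (hf : DifferentiableOn ℂ f U)
    (hi : InjOn f U) {z : ℂ} (hz : z ∈ U) : deriv f z ≠ 0 := by
  have := deriv_mul_deriv_leftInverse hU hf hi
    (g := Function.invFunOn f U) (fun w hw => hi.leftInvOn_invFunOn hw) hz
  exact right_ne_zero_of_mul_eq_one this

end Injective

end

/-! ### The Cauchy–Pompeiu formula -/

section

open Filter Topology MeasureTheory

/-- The Wirtinger derivative `∂u/∂z̄`, meaningful where `u` is real differentiable. -/
def dbar (u : ℂ → ℂ) (z : ℂ) : ℂ :=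
  (fderiv ℝ u z 1 + Complex.I * fderiv ℝ u z Complex.I) / 2

lemma continuous_dbar {u : ℂ → ℂ} (hu : ContDiff ℝ 1 u) : Continuous (dbar u) := by
  have := hu.continuous_fderiv one_ne_zero
  unfold dbar
  fun_prop

/-- For a unit vector `e`, this is the splitting of `∂u/∂z̄` into a radial and an angular derivative
in the direction `e`. -/
lemma dbar_mul_conj (u : ℂ → ℂ) (z e : ℂ) :
    dbar u z * (starRingEnd ℂ) e
      = (fderiv ℝ u z e + Complex.I * fderiv ℝ u z (Complex.I * e)) / 2 := by
  have h1 : ∀ v : ℂ, fderiv ℝ u z v = v.re * fderiv ℝ u z 1 + v.im * fderiv ℝ u z Complex.I := by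
    intro v
    have : v = v.re • (1 : ℂ) + v.im • Complex.I := by
      simp [Complex.re_add_im]
    conv_lhs => rw [this]
    rw [map_add, map_smul, map_smul]
    simp
  rw [h1 e, h1 (Complex.I * e), dbar]
  have h2 : (starRingEnd ℂ) e = e.re - e.im * Complex.I := by
    apply Complex.ext <;> simp
  rw [h2]
  simp only [Complex.mul_re, Complex.mul_im, Complex.I_re, Complex.I_im]
  push_cast
  linear_combination (-(e.im : ℂ) * fderiv ℝ u z Complex.I / 2) * Complex.I_sq

lemma dbar_eq_zero {u : ℂ → ℂ} {z : ℂ} (hu : DifferentiableAt ℂ u z) : dbar u z = 0 := by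
  have h : fderiv ℝ u z = (fderiv ℂ u z).restrictScalars ℝ :=
    (hu.hasFDerivAt.restrictScalars ℝ).fderiv
  rw [dbar, h]
  have : fderiv ℂ u z Complex.I = Complex.I * fderiv ℂ u z 1 := by
    rw [← smul_eq_mul, ← map_smul]; simp
  simp only [ContinuousLinearMap.coe_restrictScalars', this]
  linear_combination (fderiv ℂ u z 1 / 2) * Complex.I_sq

/-- The Cauchy–Pompeiu formula at the origin, by integration in polar coordinates. -/
lemma integral_dbar_div_self {u : ℂ → ℂ} (hu : ContDiff ℝ 1 u) (hc : HasCompactSupport u) :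
    ∫ z, dbar u z / z = -Real.pi * u 0 := by
  set P : ℝ × ℝ → ℂ := fun p => p.1 * Complex.exp (p.2 * Complex.I)
  set A : ℝ × ℝ → ℂ := fun p => fderiv ℝ u (P p) (Complex.exp (p.2 * Complex.I))
  set B : ℝ × ℝ → ℂ := fun p => fderiv ℝ u (P p) (Complex.I * Complex.exp (p.2 * Complex.I))
  have hu' := hu.continuous_fderiv one_ne_zero
  have hPc : Continuous P := by fun_prop
  have hAc : Continuous A := by fun_prop
  have hBc : Continuous B := by fun_prop
  obtain ⟨R, hR⟩ := hc.isCompact.isBounded.subset_closedBall (0 : ℂ)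
  have hnP : ∀ p, ‖P p‖ = |p.1| := fun p => by
    simp [P, Complex.norm_exp_ofReal_mul_I]
  have hzero : ∀ p : ℝ × ℝ, R < p.1 → fderiv ℝ u (P p) = 0 := by
    intro p hp
    apply image_eq_zero_of_notMem_tsupport
    intro h
    have h2 := hR (tsupport_fderiv_subset ℝ h)
    rw [mem_closedBall_zero_iff, hnP] at h2
    linarith [le_abs_self p.1]
  set T : Set (ℝ × ℝ) := Ioi (0 : ℝ) ×ˢ Ioo (-Real.pi) Real.pi
  have hint : ∀ f : ℝ × ℝ → ℂ, Continuous f → (∀ p : ℝ × ℝ, R < p.1 → f p = 0) →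
      IntegrableOn f T := by
    intro f hf hf0
    refine IntegrableOn.of_forall_sdiff_eq_zero (s := Icc (0 : ℝ) R ×ˢ Icc (-Real.pi) Real.pi)
      (hf.continuousOn.integrableOn_compact (isCompact_Icc.prod isCompact_Icc))
      (measurableSet_Ioi.prod measurableSet_Ioo) ?_
    rintro ⟨r, θ⟩ ⟨⟨hr, hθ⟩, h2⟩
    refine hf0 _ (not_le.1 fun h => h2 ⟨⟨(mem_Ioi.1 hr).le, h⟩, Ioo_subset_Icc_self hθ⟩)
  have hAi := hint A hAc fun p hp => by simp [A, hzero p hp]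
  have hBi := hint B hBc fun p hp => by simp [B, hzero p hp]
  -- the radial part is a derivative along each ray, from the origin to infinity
  have hA : ∫ p in T, A p = -(2 * Real.pi) * u 0 := by
    have h1 : ∀ θ : ℝ, ∫ r in Ioi (0 : ℝ), A (r, θ) = - u 0 := by
      intro θ
      set e := Complex.exp (θ * Complex.I)
      have he : ‖e‖ = 1 := Complex.norm_exp_ofReal_mul_I θ
      have hiso : Isometry fun r : ℝ => (r : ℂ) * e := by
        refine Isometry.of_dist_eq fun x y => ?_
        rw [dist_eq_norm, ← sub_mul, norm_mul, he, mul_one, ← Complex.ofReal_sub,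
          Complex.norm_real, Real.dist_eq, Real.norm_eq_abs]
      have hd : ∀ r : ℝ, HasDerivAt (fun r : ℝ => u (r * e)) (A (r, θ)) r := by
        intro r
        have := ((hu.differentiable one_ne_zero) (r * e)).hasFDerivAt.comp_hasDerivAt r
          ((Complex.ofRealCLM.hasDerivAt (x := r)).mul_const e)
        simpa [A, P, e, Function.comp_def] using! this
      have := HasCompactSupport.integral_Ioi_deriv_eq (f := fun r : ℝ => u (r * e))
        (hu.comp (Complex.ofRealCLM.contDiff.mul contDiff_const)) (hc.comp_isClosedEmbedding hiso.isClosedEmbedding) 0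
      simpa [fun r => (hd r).deriv] using this
    rw [Measure.volume_eq_prod] at hAi ⊢
    rw [setIntegral_prod _ hAi, integral_integral_swap]
    · simp only [h1, setIntegral_const]
      rw [measureReal_def, Real.volume_Ioo, ENNReal.toReal_ofReal (by linarith [Real.pi_pos]),
        Complex.real_smul]
      push_cast
      ring
    · rw [IntegrableOn, ← Measure.prod_restrict] at hAi
      exact hAi
  -- the angular part is a derivative along each circle
  have hB : ∫ p in T, B p = 0 := by
    have h1 : ∀ r ∈ Ioi (0 : ℝ), ∫ θ in Ioo (-Real.pi) Real.pi, B (r, θ) = 0 := by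
      intro r hr
      have hr0 : (r : ℂ) ≠ 0 := by exact_mod_cast (mem_Ioi.1 hr).ne'
      have hd : ∀ θ : ℝ, HasDerivAt (fun θ : ℝ => u (P (r, θ)) / r) (B (r, θ)) θ := by
        intro θ
        have h2 : HasDerivAt (fun θ : ℝ => P (r, θ))
            (r * (Complex.exp (θ * Complex.I) * Complex.I)) θ := by
          have := ((Complex.ofRealCLM.hasDerivAt (x := θ)).mul_const Complex.I).cexp
          simpa [P] using this.const_mul (r : ℂ)
        have h3 := ((hu.differentiable one_ne_zero) (P (r, θ))).hasFDerivAt.comp_hasDerivAt θ h2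
        refine (h3.div_const (r : ℂ)).congr_deriv ?_
        rw [div_eq_iff hr0, mul_comm (Complex.exp _), ← Complex.real_smul, map_smul,
          Complex.real_smul, mul_comm]
      rw [← integral_Ioc_eq_integral_Ioo, ← intervalIntegral.integral_of_le (by
        linarith [Real.pi_pos]), intervalIntegral.integral_eq_sub_of_hasDerivAt
        (fun θ _ => hd θ) ((hBc.comp (by fun_prop)).intervalIntegrable _ _)]
      simp [P, Complex.exp_neg]
    rw [Measure.volume_eq_prod] at hBi ⊢
    rw [setIntegral_prod _ hBi, setIntegral_congr_fun measurableSet_Ioi h1]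
    simp
  rw [← Complex.integral_comp_polarCoord_symm, polarCoord_target]
  have hcongr : ∀ p ∈ T, p.1 • (dbar u (Complex.polarCoord.symm p) / Complex.polarCoord.symm p)
      = A p / 2 + Complex.I * B p / 2 := by
    rintro ⟨r, θ⟩ ⟨hr, hθ⟩
    have hP : Complex.polarCoord.symm (r, θ) = P (r, θ) := by
      simp [P, Complex.exp_mul_I, Complex.polarCoord_symm_apply]
    have hr0 : (r : ℂ) ≠ 0 := by exact_mod_cast (mem_Ioi.1 hr).ne'
    have he : (starRingEnd ℂ) (Complex.exp (θ * Complex.I)) * Complex.exp (θ * Complex.I) = 1 := by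
      rw [Complex.conj_mul', Complex.norm_exp_ofReal_mul_I]; simp
    have he0 := Complex.exp_ne_zero (θ * Complex.I)
    rw [hP, Complex.real_smul, ← add_div, ← dbar_mul_conj]
    simp only [P]
    rw [mul_div_assoc', div_eq_iff (mul_ne_zero hr0 he0)]
    linear_combination (-(r : ℂ) * dbar u (r * Complex.exp (θ * Complex.I))) * he
  rw [setIntegral_congr_fun (measurableSet_Ioi.prod measurableSet_Ioo) hcongr,
    integral_add (hAi.div_const 2) ((hBi.const_mul Complex.I).div_const 2), integral_div,
    integral_div, integral_const_mul, hA, hB]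
  ring

/-- The Cauchy–Pompeiu formula for compactly supported functions. -/
lemma integral_dbar_div_sub {u : ℂ → ℂ} (hu : ContDiff ℝ 1 u) (hc : HasCompactSupport u) (w : ℂ) :
    ∫ z, dbar u z / (z - w) = -Real.pi * u w := by
  have h1 := integral_dbar_div_self (u := fun z => u (z + w)) (hu.comp (by fun_prop))
    (hc.comp_homeomorph (Homeomorph.addRight w))
  rw [zero_add] at h1
  rw [← h1, ← integral_add_right_eq_self _ w]
  congr 1
  ext z
  rw [add_sub_cancel_right, dbar, dbar, fderiv_comp_add_right]

end

/-! ### Primitives and square roots of holomorphic functions -/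

section

open Filter Topology MeasureTheory

lemma sub_div_sub_mem_slitPlane {a b w : ℂ} (h : ‖b - a‖ < ‖w - b‖) :
    (w - a) / (w - b) ∈ Complex.slitPlane := by
  have hb : w - b ≠ 0 := norm_pos_iff.1 ((norm_nonneg _).trans_lt h)
  have : (w - a) / (w - b) = 1 + (b - a) / (w - b) := by field_simp; ring
  rw [this]
  apply Complex.mem_slitPlane_of_norm_lt_one
  rwa [norm_div, div_lt_one (norm_pos_iff.2 hb)]

lemma hasDerivAt_log_sub_div_sub {a b w : ℂ} (h : (w - a) / (w - b) ∈ Complex.slitPlane) :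
    HasDerivAt (fun w => Complex.log ((w - a) / (w - b))) ((w - a)⁻¹ - (w - b)⁻¹) w := by
  have h0 := Complex.slitPlane_ne_zero h
  have hb : w - b ≠ 0 := fun h1 => h0 (by simp [h1])
  have ha : w - a ≠ 0 := fun h1 => h0 (by simp [h1])
  refine ((((hasDerivAt_id w).sub_const a).div ((hasDerivAt_id w).sub_const b) hb).clog
    h).congr_deriv ?_
  simp only [id, Pi.div_apply]
  field_simp

/-- If the Cauchy kernels with poles in the support of `h` have primitives in `V`, so has the
Cauchy transform of `h`. The difference of two kernels with near poles has the explicit primitive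
`log ((w - ζ) / (w - a))`, which depends continuously on `ζ` and can be integrated. -/
lemma isExactOn_integral_mul_inv_sub {V : Set ℂ} (hV : IsOpen V) {h : ℂ → ℂ} (hc : Continuous h)
    (hs : HasCompactSupport h)
    (hS : ∀ a ∈ tsupport h, a ∉ closure V ∧ Complex.IsExactOn (fun w => (w - a)⁻¹) V) :
    Complex.IsExactOn (fun w => ∫ ζ, h ζ * (w - ζ)⁻¹) V := by
  have hi : Integrable h := hc.integrable_of_hasCompactSupport hs
  have hint : ∀ w ∈ V, Integrable fun ζ => h ζ * (w - ζ)⁻¹ := by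
    intro w hw
    refine Continuous.integrable_of_hasCompactSupport ?_ hs.mul_right
    refine continuous_of_tsupport fun ζ hζ => ?_
    have hne : w - ζ ≠ 0 := sub_ne_zero.2 fun h1 =>
      (hS ζ (tsupport_mul_subset_left hζ)).1 (h1 ▸ subset_closure hw)
    fun_prop (disch := assumption)
  -- `p` is a property of small sets that passes to finite unions: primitives exist for the
  -- integrals over all measurable pieces of a neighbourhood
  let p : Set ℂ → Prop := fun s => ∃ t, MeasurableSet t ∧ s ⊆ t ∧ ∀ A, MeasurableSet A → A ⊆ t →
    Complex.IsExactOn (fun w => ∫ ζ in A, h ζ * (w - ζ)⁻¹) V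
  have key : p (tsupport h) := by
    refine IsCompact.induction_on hs ?_ ?_ ?_ ?_
    · refine ⟨∅, MeasurableSet.empty, subset_rfl, fun A _ hA => ⟨fun _ => 0, fun z _ => ?_⟩⟩
      rw [subset_empty_iff.1 hA]
      simpa using hasDerivAt_const z (0 : ℂ)
    · rintro s s' hss ⟨t, ht, hst, h1⟩
      exact ⟨t, ht, hss.trans hst, h1⟩
    · rintro s s' ⟨t, ht, hst, h1⟩ ⟨t', ht', hst', h1'⟩
      refine ⟨t ∪ t', ht.union ht', union_subset_union hst hst', fun A hA hAt => ?_⟩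
      obtain ⟨L, hL⟩ := h1 (A ∩ t) (hA.inter ht) inter_subset_right
      obtain ⟨L', hL'⟩ := h1' (A \ t) (hA.diff ht) (by
        rintro x ⟨hx, hxt⟩; exact (hAt hx).resolve_left hxt)
      refine ⟨L + L', fun z hz => ?_⟩
      have := (hL z hz).add (hL' z hz)
      rwa [integral_inter_add_sdiff ht (hint z hz).integrableOn] at this
    · intro a ha
      obtain ⟨hacl, L, hL⟩ := hS a ha
      obtain ⟨δ, hδ, hball⟩ := Metric.isOpen_iff.1 isClosed_closure.isOpen_compl a hacl
      have hVa : ∀ w ∈ V, δ ≤ ‖w - a‖ := by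
        intro w hw
        by_contra hlt
        exact hball (by simpa [dist_eq_norm] using hlt : w ∈ ball a δ) (subset_closure hw)
      refine ⟨ball a (δ / 2), mem_nhdsWithin_of_mem_nhds (ball_mem_nhds a (by linarith)),
        ball a (δ / 2), measurableSet_ball, subset_rfl, fun A hA hAt => ?_⟩
      have hζ : ∀ w ∈ V, ∀ ζ ∈ closedBall a (δ / 2), (w - ζ) / (w - a) ∈ Complex.slitPlane := by
        intro w hw ζ hζ
        apply sub_div_sub_mem_slitPlane
        rw [mem_closedBall, dist_comm, dist_eq_norm] at hζ
        linarith [hVa w hw]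
      have hAc : A ⊆ closedBall a (δ / 2) := hAt.trans ball_subset_closedBall
      have hcont : ∀ w ∈ V, ContinuousOn
          (fun ζ => h ζ * Complex.log ((w - ζ) / (w - a))) (closedBall a (δ / 2)) := by
        intro w hw
        refine hc.continuousOn.mul (ContinuousOn.clog ?_ (hζ w hw))
        fun_prop
      have hIF : ∀ w ∈ V, IntegrableOn (fun ζ => h ζ * Complex.log ((w - ζ) / (w - a))) A :=
        fun w hw => ((hcont w hw).integrableOn_compact (isCompact_closedBall _ _)).mono_set hAc
      have hIa : ∀ w, IntegrableOn (fun ζ => h ζ * (w - a)⁻¹) A := fun w =>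
        (hi.mul_const _).integrableOn
      refine ⟨fun w => (∫ ζ in A, h ζ * Complex.log ((w - ζ) / (w - a))) + (∫ ζ in A, h ζ) * L w,
        fun w hw => ?_⟩
      have hder := (hasDerivAt_integral_of_dominated_loc_of_deriv_le
        (μ := volume.restrict A) (𝕜 := ℂ)
        (F := fun w ζ => h ζ * Complex.log ((w - ζ) / (w - a)))
        (F' := fun w ζ => h ζ * ((w - ζ)⁻¹ - (w - a)⁻¹))
        (bound := fun ζ => ‖h ζ‖ * ((δ / 2)⁻¹ + δ⁻¹)) (x₀ := w) (s := V) (hV.mem_nhds hw)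
        ?_ (hIF w hw) ?_ ?_ (hi.norm.mul_const _).integrableOn ?_).2
      · refine (hder.add ((hL w hw).const_mul _)).congr_deriv ?_
        simp only [mul_sub]
        rw [integral_sub (hint w hw).integrableOn (hIa w), integral_mul_const]
        ring
      · filter_upwards [hV.mem_nhds hw] with v hv using (hIF v hv).aestronglyMeasurable
      · simp only [mul_sub]
        exact ((hint w hw).integrableOn.sub (hIa w)).aestronglyMeasurable
      · refine (ae_restrict_iff' hA).2 (Eventually.of_forall fun ζ hζA v hv => ?_)
        rw [norm_mul]
        gcongr
        refine (norm_sub_le _ _).trans ?_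
        rw [norm_inv, norm_inv]
        have h1 := hVa v hv
        have h2 := hAc hζA
        rw [mem_closedBall, dist_eq_norm] at h2
        have h3 : δ / 2 ≤ ‖v - ζ‖ := by
          have : ‖v - a‖ ≤ ‖v - ζ‖ + ‖ζ - a‖ := by
            simpa using norm_add_le (v - ζ) (ζ - a)
          linarith
        gcongr
      · refine (ae_restrict_iff' hA).2 (Eventually.of_forall fun ζ hζA v hv => ?_)
        exact (hasDerivAt_log_sub_div_sub (hζ v hv ζ (hAc hζA))).const_mul _
  obtain ⟨t, ht, hst, h1⟩ := key
  have h2 := h1 t ht subset_rfl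
  convert h2 using 2 with w
  rw [setIntegral_eq_integral_of_forall_compl_eq_zero]
  intro ζ hζ
  rw [image_eq_zero_of_notMem_tsupport fun h3 => hζ (hst h3), zero_mul]

/-- Primitives on relatively compact open subsets: the Cauchy–Pompeiu formula for `χ * F`, with a
cut-off function `χ`, writes `F` as a superposition of Cauchy kernels with poles off the compact
set of those poles whose kernels have no primitive. -/
lemma isExactOn_of_closure_subset {G V : Set ℂ} (hG : IsOpen G) (hb : Bornology.IsBounded G)
    (hex : ∀ a ∉ G, Complex.IsExactOn (fun w => (w - a)⁻¹) G) (hV : IsOpen V)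
    (hVG : closure V ⊆ G) {F : ℂ → ℂ} (hF : DifferentiableOn ℂ F G) :
    Complex.IsExactOn F V := by
  set S : Set ℂ := {a | a ∉ closure V ∧ Complex.IsExactOn (fun w => (w - a)⁻¹) V}
  have hS : IsOpen S := by
    rw [Metric.isOpen_iff]
    rintro a ⟨hacl, L, hL⟩
    obtain ⟨δ, hδ, hball⟩ := Metric.isOpen_iff.1 isClosed_closure.isOpen_compl a hacl
    refine ⟨δ, hδ, fun b hb => ⟨hball hb, fun w => Complex.log ((w - b) / (w - a)) + L w,
      fun w hw => ?_⟩⟩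
    have h1 : (w - b) / (w - a) ∈ Complex.slitPlane := by
      apply sub_div_sub_mem_slitPlane
      rw [← dist_eq_norm, dist_comm, ← dist_eq_norm]
      refine (mem_ball.1 hb).trans_le ?_
      by_contra hlt
      exact hball (by simpa using hlt : w ∈ ball a δ) (subset_closure hw)
    exact ((hasDerivAt_log_sub_div_sub h1).add (hL w hw)).congr_deriv (by ring)
  -- `Sᶜ` is the closure of `V` with the holes filled; it is compact because no hole leaves `G`
  have hGS : Sᶜ ⊆ G := by
    intro a ha
    by_contra haG
    obtain ⟨L, hL⟩ := hex a haG
    exact ha ⟨fun h => haG (hVG h), L, fun w hw => hL w (hVG (subset_closure hw))⟩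
  have hZ : IsCompact Sᶜ := Metric.isCompact_of_isClosed_isBounded hS.isClosed_compl
    (hb.subset hGS)
  obtain ⟨t, ht, hZt, htG⟩ := exists_compact_between hZ hG hGS
  obtain ⟨χ, hχ1, hχ0, -⟩ := exists_contMDiffMap_one_nhds_of_subset_interior
    (modelWithCornersSelf ℝ ℂ) (n := 1) hZ.isClosed hZt
  have hχ : ContDiff ℝ 1 χ := χ.contMDiff.contDiff
  set u : ℂ → ℂ := fun z => χ z * F z
  have hu0 : ∀ z ∉ t, u z = 0 := fun z hz => by simp [u, hχ0 z hz]
  have hu : ContDiff ℝ 1 u := by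
    refine contDiff_iff_contDiffAt.2 fun z => ?_
    by_cases hz : z ∈ G
    · have h1 : ContDiffAt ℝ 1 F z :=
        ((hF.contDiffOn hG).contDiffAt (hG.mem_nhds hz)).restrict_scalars ℝ
      exact (Complex.ofRealCLM.contDiff.comp hχ).contDiffAt.mul h1
    · have : u =ᶠ[𝓝 z] fun _ => 0 := by
        filter_upwards [ht.isClosed.isOpen_compl.mem_nhds fun h => hz (htG h)] with y hy
          using hu0 y hy
      exact contDiffAt_const.congr_of_eventuallyEq this
  have huc : HasCompactSupport u := HasCompactSupport.of_support_subset_isCompact ht fun z hz => by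
    by_contra h
    exact hz (hu0 z h)
  have hhc : HasCompactSupport (dbar u) := by
    refine HasCompactSupport.of_support_subset_isCompact huc.isCompact fun z hz => ?_
    by_contra h
    have := image_eq_zero_of_notMem_tsupport fun h' => h (tsupport_fderiv_subset ℝ h')
    exact hz (by simp [dbar, this])
  have huF : ∀ z ∈ Sᶜ, ∀ᶠ y in 𝓝 z, u y = F y := by
    intro z hz
    filter_upwards [hχ1.filter_mono (nhds_le_nhdsSet hz)] with y hy
    simp [u, hy]
  have hsupp : tsupport (dbar u) ⊆ S := by
    intro z hz
    by_contra hzS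
    refine notMem_tsupport_iff_eventuallyEq.2 ?_ hz
    filter_upwards [(huF z hzS).eventually_nhds, hG.mem_nhds (hGS hzS)] with y hy hyG
    exact dbar_eq_zero
      ((hF.differentiableAt (hG.mem_nhds hyG)).congr_of_eventuallyEq hy)
  obtain ⟨P, hP⟩ := isExactOn_integral_mul_inv_sub hV (continuous_dbar hu) hhc
    fun a ha => hsupp ha
  refine ⟨fun w => (Real.pi : ℂ)⁻¹ * P w, fun w hw => ?_⟩
  refine ((hP w hw).const_mul _).congr_deriv ?_
  have hwS : w ∈ Sᶜ := fun h => h.1 (subset_closure hw)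
  have h1 := integral_dbar_div_sub hu huc w
  rw [(huF w hwS).self_of_nhds] at h1
  have h2 : ∫ ζ, dbar u ζ * (w - ζ)⁻¹ = - ∫ ζ, dbar u ζ / (ζ - w) := by
    rw [← integral_neg]
    congr 1
    ext ζ
    rw [← neg_sub ζ w, inv_neg, div_eq_mul_inv, mul_neg]
  have hpi : (Real.pi : ℂ) ≠ 0 := by exact_mod_cast Real.pi_ne_zero
  beta_reduce
  rw [h2, h1]
  field_simp

/-- A bounded domain `G` in which every Cauchy kernel with pole off `G` has a primitive is simply
connected in the sense that every holomorphic function on `G` has a primitive. -/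
lemma isExactOn_of_forall_notMem {G : Set ℂ} (hG : IsOpen G) (hc : IsConnected G)
    (hb : Bornology.IsBounded G) (hex : ∀ a ∉ G, Complex.IsExactOn (fun w => (w - a)⁻¹) G)
    {F : ℂ → ℂ} (hF : DifferentiableOn ℂ F G) : Complex.IsExactOn F G := by
  obtain ⟨z₀, hz₀⟩ := hc.nonempty
  have hne : (Gᶜ).Nonempty := by
    rw [nonempty_compl]
    rintro rfl
    exact NormedSpace.unbounded_univ ℂ ℂ hb
  -- exhaustion of `G` by connected open sets, with primitives that agree at `z₀`
  set W : ℕ → Set ℂ := fun n => {w | 1 / ((n : ℝ) + 1) < infDist w Gᶜ}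
  have hWo : ∀ n, IsOpen (W n) := fun n =>
    isOpen_lt continuous_const (continuous_infDist_pt _)
  set V : ℕ → Set ℂ := fun n => connectedComponentIn (W n) z₀
  have hVo : ∀ n, IsOpen (V n) := fun n => (hWo n).connectedComponentIn
  have hVc : ∀ n, closure (V n) ⊆ G := by
    intro n
    have h1 : closure (V n) ⊆ {w | 1 / ((n : ℝ) + 1) ≤ infDist w Gᶜ} :=
      closure_minimal ((connectedComponentIn_subset _ _).trans fun w hw => (mem_ofPred.1 hw).le)
        (isClosed_le continuous_const (continuous_infDist_pt _))
    refine h1.trans fun w hw => ?_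
    by_contra hwG
    have h2 : 1 / ((n : ℝ) + 1) ≤ 0 :=
      (mem_ofPred.1 hw).trans_eq (infDist_zero_of_mem (mem_compl hwG))
    exact absurd h2 (not_le.2 Nat.one_div_pos_of_nat)
  have hVm : Monotone V := by
    intro m n hmn
    refine connectedComponentIn_mono _ fun w hw => mem_ofPred.2 (lt_of_le_of_lt ?_ (mem_ofPred.1 hw))
    exact Nat.one_div_le_one_div hmn
  have hcov : ∀ w ∈ G, ∃ n, w ∈ V n := by
    intro w hw
    obtain ⟨γ, hγ⟩ := ((hG.isConnected_iff_isPathConnected).1 hc).joinedIn z₀ hz₀ w hw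
    have hK : IsCompact (range γ) := isCompact_range γ.continuous
    obtain ⟨x, ⟨s, rfl⟩, hmin⟩ := hK.exists_isMinOn (range_nonempty γ)
      (continuous_infDist_pt Gᶜ).continuousOn
    have hpos : 0 < infDist (γ s) Gᶜ :=
      (hG.isClosed_compl.notMem_iff_infDist_pos hne).1 (not_not.2 (hγ s))
    obtain ⟨n, hn⟩ := exists_nat_one_div_lt hpos
    refine ⟨n, (isPreconnected_range γ.continuous).subset_connectedComponentIn
      (x := z₀) ⟨0, γ.source⟩ ?_ ⟨1, γ.target⟩⟩
    intro y hy
    exact hn.trans_le (hmin hy)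
  have hprim : ∀ n, ∃ P : ℂ → ℂ, P z₀ = 0 ∧ ∀ w ∈ V n, HasDerivAt P (F w) w := fun n =>
    (isExactOn_of_closure_subset hG hb hex (hVo n) (hVc n) hF).with_val_at z₀ 0
  choose P hP0 hP using hprim
  have hcomp : ∀ m n, m ≤ n → EqOn (P m) (P n) (V m) := by
    intro m n hmn w hw
    have hz : z₀ ∈ V m := by
      refine mem_connectedComponentIn ?_
      by_contra h
      have h1 : V m = ∅ := connectedComponentIn_eq_empty h
      rw [h1] at hw
      exact hw
    refine (hVo m).eqOn_of_deriv_eq isPreconnected_connectedComponentIn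
      (fun v hv => (hP m v hv).differentiableAt.differentiableWithinAt)
      (fun v hv => (hP n v (hVm hmn hv)).differentiableAt.differentiableWithinAt)
      (fun v hv => ?_) hz (by rw [hP0, hP0]) hw
    rw [(hP m v hv).deriv, (hP n v (hVm hmn hv)).deriv]
  choose! N hN using hcov
  refine ⟨fun w => P (N w) w, fun w hw => (hP (N w) w (hN w hw)).congr_of_eventuallyEq ?_⟩
  filter_upwards [(hVo (N w)).mem_nhds (hN w hw)] with v hv
  have hvG : v ∈ G := hVc _ (subset_closure hv)
  rcases le_total (N v) (N w) with h | h
  · exact hcomp _ _ h (hN v hvG)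
  · exact (hcomp _ _ h hv).symm

/-- Square roots of non-vanishing holomorphic functions, from a primitive of the logarithmic
derivative. -/
lemma exists_sq_eq_of_isExactOn {G : Set ℂ} (hG : IsOpen G) (hc : IsConnected G)
    (hex : ∀ F : ℂ → ℂ, DifferentiableOn ℂ F G → Complex.IsExactOn F G) {f : ℂ → ℂ}
    (hf : DifferentiableOn ℂ f G) (h0 : ∀ z ∈ G, f z ≠ 0) :
    ∃ g : ℂ → ℂ, DifferentiableOn ℂ g G ∧ ∀ z ∈ G, g z ^ 2 = f z := by
  obtain ⟨z₀, hz₀⟩ := hc.nonempty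
  obtain ⟨L, hL0, hL⟩ := (hex (fun z => deriv f z / f z)
    ((hf.deriv hG).div hf h0)).with_val_at z₀ (Complex.log (f z₀))
  have hd : ∀ z ∈ G, HasDerivAt (fun z => Complex.exp (-L z) * f z) 0 z := by
    intro z hz
    refine (((hL z hz).neg.cexp).mul
      (hf.differentiableAt (hG.mem_nhds hz)).hasDerivAt).congr_deriv ?_
    have := h0 z hz
    simp only [Pi.neg_apply]
    field_simp
    ring
  have hconst : ∀ z ∈ G, Complex.exp (-L z) * f z = 1 := by
    intro z hz
    have h1 := hG.is_const_of_deriv_eq_zero hc.isPreconnected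
      (fun z hz => (hd z hz).differentiableAt.differentiableWithinAt)
      (fun z hz => (hd z hz).deriv) hz hz₀
    rw [h1, hL0, Complex.exp_neg, Complex.exp_log (h0 z₀ hz₀), inv_mul_cancel₀ (h0 z₀ hz₀)]
  refine ⟨fun z => Complex.exp (L z / 2), fun z hz =>
    ((hL z hz).div_const 2).cexp.differentiableAt.differentiableWithinAt, fun z hz => ?_⟩
  rw [← Complex.exp_nat_mul]
  have h1 := hconst z hz
  rw [Complex.exp_neg, inv_mul_eq_one₀ (Complex.exp_ne_zero _)] at h1
  rw [← h1]
  congr 1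
  push_cast
  ring

end

/-! ### The Riemann mapping theorem -/

section

open Filter Topology

/-- Montel's theorem, in the form of convergence along an ultrafilter. -/
lemma exists_tendstoLocallyUniformlyOn {U : Set ℂ} (hU : IsOpen U) {f : ℕ → ℂ → ℂ}
    (hf : ∀ n, DifferentiableOn ℂ (f n) U) (hm : ∀ n, MapsTo (f n) U (closedBall 0 1))
    (l : Ultrafilter ℕ) : ∃ g : ℂ → ℂ, TendstoLocallyUniformlyOn f g l U := by
  have hlim : ∀ z ∈ U, ∃ y, Tendsto (fun n => f n z) l (𝓝 y) := by
    intro z hz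
    obtain ⟨y, -, hy⟩ := (isCompact_closedBall (0 : ℂ) 1).ultrafilter_le_nhds
      (l.map fun n => f n z) (by
        exact tendsto_principal.2 (Eventually.of_forall fun n => hm n hz))
    exact ⟨y, hy⟩
  choose! g hg using hlim
  refine ⟨g, Metric.tendstoLocallyUniformlyOn_iff.2 fun ε hε x hx => ?_⟩
  obtain ⟨r, hr, hball⟩ := Metric.isOpen_iff.1 hU x hx
  have hlip : ∀ n, ∀ y ∈ ball x r, dist (f n y) (f n x) ≤ 2 / r * dist y x := by
    intro n y hy
    refine Complex.dist_le_div_mul_dist_of_mapsTo_ball ((hf n).mono hball) (fun w hw => ?_) hy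
    have h1 := hm n (hball hw)
    have h2 := hm n hx
    rw [mem_closedBall] at h1 h2 ⊢
    linarith [dist_triangle_right (f n w) (f n x) 0]
  have hglip : ∀ y ∈ ball x r, dist (g y) (g x) ≤ 2 / r * dist y x := fun y hy =>
    le_of_tendsto ((hg y (hball hy)).dist (hg x hx)) (Eventually.of_forall fun n => hlip n y hy)
  refine ⟨ball x (min r (ε * r / 8)),
    mem_nhdsWithin_of_mem_nhds (ball_mem_nhds x (by positivity)), ?_⟩
  filter_upwards [(hg x hx).eventually (ball_mem_nhds (g x) (show 0 < ε / 4 by linarith))]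
    with n hn y hy
  have hy1 : y ∈ ball x r := ball_subset_ball (min_le_left _ _) hy
  have hy2 : 2 / r * dist y x ≤ ε / 4 := by
    have : dist y x ≤ ε * r / 8 := (mem_ball.1 hy).le.trans (min_le_right _ _)
    calc 2 / r * dist y x ≤ 2 / r * (ε * r / 8) := by gcongr
      _ = ε / 4 := by field_simp; norm_num
  have h1 := hlip n y hy1
  have h2 := hglip y hy1
  have h3 := dist_triangle4 (g y) (g x) (f n x) (f n y)
  rw [dist_comm (g x), dist_comm (f n x) (f n y)] at h3
  linarith

/-- Hurwitz's theorem: a nonconstant locally uniform limit of injective holomorphic functions is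
injective. -/
lemma injOn_of_tendstoLocallyUniformlyOn {U : Set ℂ} (hU : IsOpen U) (hc : IsPreconnected U)
    {f : ℕ → ℂ → ℂ} {g : ℂ → ℂ} {l : Filter ℕ} [l.NeBot]
    (hf : ∀ n, DifferentiableOn ℂ (f n) U) (hi : ∀ n, InjOn (f n) U)
    (hfg : TendstoLocallyUniformlyOn f g l U) {z₀ : ℂ} (hz₀ : z₀ ∈ U) (hd : deriv g z₀ ≠ 0) :
    InjOn g U := by
  have hg : DifferentiableOn ℂ g U := hfg.differentiableOn (Eventually.of_forall hf) hU
  intro a ha b hb hab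
  by_contra hne
  have hpunct : ∀ᶠ w in 𝓝[≠] b, g w - g a ≠ 0 := by
    refine (((hg.sub_const (g a)).analyticOnNhd hU) b
      hb).eventually_eq_zero_or_eventually_ne_zero.resolve_left fun h => hd ?_
    have h1 := ((hg.sub_const (g a)).analyticOnNhd
      hU).eqOn_zero_of_preconnected_of_eventuallyEq_zero hc hb h
    have h2 : g =ᶠ[𝓝 z₀] fun _ => g a := by
      filter_upwards [hU.mem_nhds hz₀] with w hw using sub_eq_zero.1 (h1 hw)
    rw [h2.deriv_eq, deriv_const]
  have h3 : ∀ᶠ w in 𝓝 b, (w ≠ b → g w - g a ≠ 0) ∧ w ∈ U ∧ w ≠ a :=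
    (eventually_nhdsWithin_iff.1 hpunct).and ((show ∀ᶠ w in 𝓝 b, w ∈ U from hU.mem_nhds hb).and
      (eventually_ne_nhds (Ne.symm hne)))
  obtain ⟨r, hr, hball⟩ := Metric.nhds_basis_closedBall.eventually_iff.1 h3
  have hsub : closedBall b r ⊆ U := fun w hw => (hball hw).2.1
  obtain ⟨w₀, hw₀, hmin⟩ := (isCompact_sphere b r).exists_isMinOn
    (NormedSpace.sphere_nonempty.2 hr.le)
    ((hg.continuousOn.mono (sphere_subset_closedBall.trans hsub)).sub
      (continuousOn_const (c := g a))).norm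
  set m := ‖g w₀ - g a‖
  have hm : 0 < m := norm_pos_iff.2 ((hball (sphere_subset_closedBall hw₀)).1 fun h => by
    rw [h, mem_sphere, dist_self] at hw₀
    exact hr.ne hw₀)
  have hunif := (tendstoLocallyUniformlyOn_iff_forall_isCompact hU).1 hfg _ hsub
    (isCompact_closedBall b r)
  have hm12 : 0 < m / 12 := by positivity
  obtain ⟨n, hn1, hn2⟩ := ((Metric.tendstoUniformlyOn_iff.1 hunif _ hm12).and
    ((hfg.tendsto_at ha).eventually (ball_mem_nhds (g a) hm12))).exists
  have hb' := hn1 b (mem_closedBall_self hr.le)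
  rw [dist_eq_norm] at hb'
  rw [dist_eq_norm] at hn2
  have hfb : ‖f n a - f n b‖ < m / 3 := by
    have : f n a - f n b = (f n a - g a) + (g b - f n b) := by rw [hab]; ring
    rw [this]
    linarith [norm_add_le (f n a - g a) (g b - f n b)]
  -- `f n` takes the value `f n a` in the closed ball about `b` too, by the minimum principle
  have hsph : ∀ z ∈ sphere b r, 2 * m / 3 ≤ ‖f n z - f n b‖ := by
    intro z hz
    have h4 : m ≤ ‖g z - g a‖ := hmin hz
    have h5 := hn1 z (sphere_subset_closedBall hz)
    rw [dist_eq_norm] at h5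
    have h6 : g z - g a = (g z - f n z) + (f n z - f n b) + (f n b - g b) := by rw [hab]; ring
    rw [norm_sub_rev] at hb'
    have h7 := norm_add₃_le (a := g z - f n z) (b := f n z - f n b) (c := f n b - g b)
    rw [← h6] at h7
    linarith
  have hfreq : ∃ᶠ z in 𝓝 b, f n z ≠ f n b := by
    have : ∀ᶠ z in 𝓝[≠] b, f n z ≠ f n b := by
      filter_upwards [self_mem_nhdsWithin, nhdsWithin_le_nhds (hU.mem_nhds hb)] with z hz hzU h
      exact hz (hi n hzU hb h)
    exact this.frequently.filter_mono nhdsWithin_le_nhds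
  obtain ⟨w, hw, hwa⟩ := ((hf n).diffContOnCl_ball hsub).ball_subset_image_closedBall hr hsph
    hfreq (show f n a ∈ ball (f n b) (2 * m / 3 / 2) by
      rw [mem_ball, dist_eq_norm]; linarith)
  exact (hball hw).2.2 (hi n (hsub hw) ha hwa)

/-- The Riemann mapping theorem for domains in the unit disk in which non-vanishing holomorphic
functions have square roots. -/
theorem exists_bijOn_ball {G : Set ℂ} (hG : IsOpen G) (hc : IsConnected G)
    (hGD : G ⊆ ball 0 1)
    (hsq : ∀ f : ℂ → ℂ, DifferentiableOn ℂ f G → (∀ z ∈ G, f z ≠ 0) →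
      ∃ g : ℂ → ℂ, DifferentiableOn ℂ g G ∧ ∀ z ∈ G, g z ^ 2 = f z)
    {z₀ : ℂ} (hz₀ : z₀ ∈ G) :
    ∃ f : ℂ → ℂ, DifferentiableOn ℂ f G ∧ BijOn f G (ball 0 1) ∧ f z₀ = 0 := by
  set 𝓕 : Set (ℂ → ℂ) :=
    {f | DifferentiableOn ℂ f G ∧ MapsTo f G (ball 0 1) ∧ InjOn f G ∧ f z₀ = 0}
  set S : Set ℝ := (fun f : ℂ → ℂ => ‖deriv f z₀‖) '' 𝓕
  have hz₀' : ‖z₀‖ < 1 := by simpa using hGD hz₀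
  have hid : diskAut z₀ ∈ 𝓕 := ⟨(differentiableOn_diskAut hz₀').mono hGD,
    (diskAut_mapsTo hz₀').mono_left hGD, (diskAut_injOn hz₀').mono hGD, diskAut_self z₀⟩
  have hbdd : BddAbove S := by
    obtain ⟨r, hr, hball⟩ := Metric.isOpen_iff.1 hG z₀ hz₀
    refine ⟨1 / r, ?_⟩
    rintro _ ⟨f, ⟨hf, hm, -, h0⟩, rfl⟩
    refine Complex.norm_deriv_le_div_of_mapsTo_ball (hf.mono hball) (fun z hz => ?_) hr
    rw [h0]
    exact ball_subset_closedBall (hm (hball hz))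
  obtain ⟨u, -, hu, huS⟩ := exists_seq_tendsto_sSup (S := S) ⟨_, mem_image_of_mem _ hid⟩ hbdd
  set M := sSup S
  have hM : ∀ f ∈ 𝓕, ‖deriv f z₀‖ ≤ M := fun f hf => le_csSup hbdd (mem_image_of_mem _ hf)
  have hMpos : 0 < M := (norm_pos_iff.2 (deriv_ne_zero_of_injOn hG hid.1 hid.2.2.1 hz₀)).trans_le
    (hM _ hid)
  choose f hf𝓕 hfu using huS
  obtain ⟨g, hg⟩ := exists_tendstoLocallyUniformlyOn hG (fun n => (hf𝓕 n).1)
    (fun n => (hf𝓕 n).2.1.mono_right ball_subset_closedBall) (hyperfilter ℕ)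
  have hgd : DifferentiableOn ℂ g G :=
    hg.differentiableOn (Eventually.of_forall fun n => (hf𝓕 n).1) hG
  have hgM : ‖deriv g z₀‖ = M := by
    have h1 := ((hg.deriv (Eventually.of_forall fun n => (hf𝓕 n).1) hG).tendsto_at hz₀).norm
    have h2 : Tendsto (fun n => ‖(deriv ∘ f) n z₀‖) (hyperfilter ℕ : Filter ℕ) (𝓝 M) := by
      have h3 := hu.mono_left Nat.hyperfilter_le_atTop
      exact h3.congr fun n => (hfu n).symm
    exact tendsto_nhds_unique h1 h2
  have hgi : InjOn g G := injOn_of_tendstoLocallyUniformlyOn hG hc.isPreconnected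
    (fun n => (hf𝓕 n).1) (fun n => (hf𝓕 n).2.2.1) hg hz₀
    (norm_pos_iff.1 (by rw [hgM]; exact hMpos))
  have hg0 : g z₀ = 0 := by
    refine tendsto_nhds_unique (hg.tendsto_at hz₀) ?_
    simp only [fun n => (hf𝓕 n).2.2.2]
    exact tendsto_const_nhds
  have hgm : MapsTo g G (ball 0 1) := by
    have h1 : g '' G ⊆ closedBall 0 1 := by
      rintro _ ⟨z, hz, rfl⟩
      exact isClosed_closedBall.mem_of_tendsto (hg.tendsto_at hz)
        (Eventually.of_forall fun n => ball_subset_closedBall ((hf𝓕 n).2.1 hz))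
    have h2 := (isOpen_image_of_injOn hG hgd hgi).subset_interior_iff.2 h1
    rw [interior_closedBall _ one_ne_zero] at h2
    exact mapsTo_iff_image_subset.2 h2
  refine ⟨g, hgd, ⟨hgm, hgi, fun b hb => ?_⟩, hg0⟩
  -- Otherwise Koebe's square root construction gives a competitor with larger derivative.
  by_contra hbG
  have hb' : ‖b‖ < 1 := by simpa using hb
  have hnb : ‖-b‖ < 1 := by simpa using hb'
  obtain ⟨h, hhd, hh⟩ := hsq (diskAut b ∘ g) ((differentiableOn_diskAut hb').comp hgd hgm)
    fun z hz h0 => hbG ⟨z, hz, diskAut_injOn hb' (hgm hz) hb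
      (by rw [diskAut_self]; exact h0)⟩
  have hhm : MapsTo h G (ball 0 1) := by
    intro z hz
    have h1 := diskAut_mapsTo hb' (hgm hz)
    have h2 := hh z hz
    rw [Function.comp_apply] at h2
    rw [← h2, mem_ball_zero_iff, norm_pow] at h1
    rw [mem_ball_zero_iff]
    exact lt_of_pow_lt_pow_left₀ 2 zero_le_one (by simpa using h1)
  set c := h z₀
  have hcb : ‖c‖ < 1 := by simpa using hhm hz₀
  have hnc : ‖-c‖ < 1 := by simpa using hcb
  have hF : diskAut c ∘ h ∈ 𝓕 := by
    refine ⟨(differentiableOn_diskAut hcb).comp hhd hhm, (diskAut_mapsTo hcb).comp hhm,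
      (diskAut_injOn hcb).comp (fun z hz w hw hzw => ?_) hhm, diskAut_self c⟩
    refine hgi hz hw (diskAut_injOn hb' (hgm hz) (hgm hw) ?_)
    have h1 := hh z hz
    rw [hzw, hh w hw] at h1
    exact h1.symm
  have hsqm : MapsTo (fun w : ℂ => w ^ 2) (ball 0 1) (ball 0 1) := by
    intro w hw
    rw [mem_ball_zero_iff] at hw ⊢
    rw [norm_pow]
    exact pow_lt_one₀ (norm_nonneg _) hw two_ne_zero
  set ψ : ℂ → ℂ := fun w => diskAut (-b) (diskAut (-c) w ^ 2)
  have hψm : MapsTo ψ (ball 0 1) (ball 0 1) := fun w hw =>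
    diskAut_mapsTo hnb (hsqm (diskAut_mapsTo hnc hw))
  have hψd : DifferentiableOn ℂ ψ (ball 0 1) :=
    (differentiableOn_diskAut hnb).comp ((differentiableOn_diskAut hnc).pow 2)
      fun w hw => hsqm (diskAut_mapsTo hnc hw)
  have hψ0 : ψ 0 = 0 := by
    have h1 : c ^ 2 = -b := by rw [hh z₀ hz₀, Function.comp_apply, hg0, diskAut_zero]
    simp only [ψ, diskAut_zero, neg_neg, h1, diskAut_self]
  have hgψ : ∀ z ∈ G, ψ ((diskAut c ∘ h) z) = g z := by
    intro z hz
    simp only [ψ, Function.comp_apply]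
    rw [diskAut_neg_diskAut hcb (by simpa using hhm hz), hh z hz, Function.comp_apply,
      diskAut_neg_diskAut hb' (by simpa using hgm hz)]
  have hder : deriv g z₀ = deriv ψ 0 * deriv (diskAut c ∘ h) z₀ := by
    have h1 : HasDerivAt ψ (deriv ψ 0) ((diskAut c ∘ h) z₀) := by
      rw [hF.2.2.2]
      exact (hψd.differentiableAt (ball_mem_nhds 0 one_pos)).hasDerivAt
    have h2 := h1.comp z₀ (hF.1.differentiableAt (hG.mem_nhds hz₀)).hasDerivAt
    refine (h2.congr_of_eventuallyEq ?_).deriv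
    filter_upwards [hG.mem_nhds hz₀] with z hz using (hgψ z hz).symm
  have hsch := norm_deriv_mul_le_one hψd hψm (mem_ball_self one_pos) hψ0
  have hge : 1 ≤ ‖deriv ψ 0‖ := by
    have h1 := hM _ hF
    rw [← hgM, hder, norm_mul] at h1
    have h2 : 0 < ‖deriv (diskAut c ∘ h) z₀‖ :=
      norm_pos_iff.2 (deriv_ne_zero_of_injOn hG hF.1 hF.2.2.1 hz₀)
    exact (le_mul_iff_one_le_left h2).1 h1
  simp only [norm_zero, ne_eq, OfNat.ofNat_ne_zero, not_false_eq_true, zero_pow, sub_zero,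
    mul_one] at hsch
  have hinj := (hsch.2 (le_antisymm hsch.1 hge)).injOn
  have hp : (1 / 2 : ℂ) ∈ ball (0 : ℂ) 1 := by simp; norm_num
  have hq : (-(1 / 2) : ℂ) ∈ ball (0 : ℂ) 1 := by simp; norm_num
  have heq : diskAut c (1 / 2) = diskAut c (-(1 / 2)) := by
    refine hinj (diskAut_mapsTo hcb hp) (diskAut_mapsTo hcb hq) ?_
    simp only [ψ]
    rw [diskAut_neg_diskAut hcb (by simpa using hp), diskAut_neg_diskAut hcb (by simpa using hq),
      neg_sq]
  have := diskAut_injOn hcb hp hq heq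
  norm_num at this

end

/-! ### Horo-convex domains and horo-crescents -/

section

open Filter Topology

/-- The quotient is a nonpositive real exactly on the segment, so `log ((w - a) / (w - b))` is
holomorphic off the segment. -/
lemma sub_div_sub_mem_slitPlane_of_notMem_segment {a b w : ℂ} (h : w ∉ segment ℝ a b) :
    (w - a) / (w - b) ∈ Complex.slitPlane := by
  by_contra hs
  have hb : w - b ≠ 0 := fun h1 => h (by rw [sub_eq_zero.1 h1]; exact right_mem_segment ℝ a b)
  rw [Complex.mem_slitPlane_iff, not_or, not_lt, not_not] at hs
  obtain ⟨hre, him⟩ := hs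
  set q := (w - a) / (w - b)
  set t : ℝ := -q.re
  have ht : 0 ≤ t := by simpa [t] using hre
  have hq : q = -(t : ℂ) := by apply Complex.ext <;> simp [t, him]
  have h1 : w - a = -(t : ℂ) * (w - b) := by rw [← hq]; exact (div_mul_cancel₀ _ hb).symm
  have ht1 : (1 + t : ℝ) ≠ 0 := by positivity
  have ht1' : (1 + t : ℂ) ≠ 0 := by exact_mod_cast ht1
  refine h ⟨1 / (1 + t), t / (1 + t), by positivity, by positivity, by field_simp, ?_⟩
  rw [Complex.real_smul, Complex.real_smul]
  push_cast
  field_simp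
  linear_combination -h1

lemma isExactOn_inv_sub_of_segment {G : Set ℂ} {a b : ℂ} (h : Disjoint G (segment ℝ a b))
    (hb : Complex.IsExactOn (fun w => (w - b)⁻¹) G) :
    Complex.IsExactOn (fun w => (w - a)⁻¹) G := by
  obtain ⟨L, hL⟩ := hb
  refine ⟨fun w => Complex.log ((w - a) / (w - b)) + L w, fun w hw => ?_⟩
  exact ((hasDerivAt_log_sub_div_sub (sub_div_sub_mem_slitPlane_of_notMem_segment
    (disjoint_left.1 h hw))).add (hL w hw)).congr_deriv (by ring)

lemma isExactOn_inv_sub_of_one_le_norm {G : Set ℂ} (hG : G ⊆ ball 0 1) {a : ℂ} (ha : 1 ≤ ‖a‖) :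
    Complex.IsExactOn (fun w => (w - a)⁻¹) G := by
  have ha0 : a ≠ 0 := norm_pos_iff.1 (one_pos.trans_le ha)
  refine ⟨fun w => Complex.log (1 + -w / a), fun w hw => ?_⟩
  have hw' : ‖w‖ < 1 := by simpa using hG hw
  have h1 : 1 + -w / a ∈ Complex.slitPlane := by
    apply Complex.mem_slitPlane_of_norm_lt_one
    rw [norm_div, norm_neg, div_lt_one (by linarith)]
    linarith
  have hwa : w - a ≠ 0 := sub_ne_zero.2 fun h => by rw [h] at hw'; linarith
  refine ((((hasDerivAt_id w).neg.div_const a).const_add 1).clog h1).congr_deriv ?_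
  have h0 := Complex.slitPlane_ne_zero h1
  have h2 : 1 + -w / a = -(w - a) / a := by field_simp; ring
  simp only [Pi.neg_apply, id, h2] at h0 ⊢
  field_simp

variable {G : Set ℂ}

lemma disjoint_closedBall_of_isHorodisk {ζ : ℂ} {r : ℝ} (hr : 0 < r) (hG : IsOpen G)
    (h : G ∩ ball ((1 - r : ℝ) * ζ) r = ∅) : Disjoint G (closedBall ((1 - r : ℝ) * ζ) r) := by
  rw [← closure_ball _ hr.ne']
  exact (disjoint_iff_inter_eq_empty.2 h).closure_right hG

lemma mem_closedBall_horodisk {ζ : ℂ} {r : ℝ} (hζ : ‖ζ‖ = 1) (hr : 0 < r) :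
    ζ ∈ closedBall ((1 - r : ℝ) * ζ) r := by
  rw [mem_closedBall, dist_eq_norm]
  have : ζ - (1 - r : ℝ) * ζ = (r : ℂ) * ζ := by push_cast; ring
  rw [this, norm_mul, hζ, Complex.norm_real, Real.norm_of_nonneg hr.le, mul_one]

/-- The topological heart of the existence of conformal maps: a point off `G` is joined to the unit
circle by at most two segments off `G`, the first one to the nearest point of the closure of `G`,
the second one in a closed horodisk, to its point of tangency. -/
lemma IsHoroConvex.isExactOn_inv_sub (hG : IsHoroConvex G) {a : ℂ} (ha : a ∉ G) :
    Complex.IsExactOn (fun w => (w - a)⁻¹) G := by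
  obtain ⟨b, hb, hdist⟩ := isClosed_closure.exists_infDist_eq_dist
    hG.isConnected.nonempty.closure a
  have hmin : ∀ w ∈ G, dist a b ≤ dist a w := fun w hw =>
    hdist ▸ infDist_le_dist_of_mem (subset_closure hw)
  have hbG : b ∉ G := by
    intro hbG
    have hab : a ≠ b := fun h => ha (h ▸ hbG)
    have h1 : b ∈ closure (ball a (dist a b)) := by
      rw [closure_ball _ (dist_ne_zero.2 hab), mem_closedBall, dist_comm]
    obtain ⟨w, hw, hwG⟩ := mem_closure_iff.1 h1 G hG.isOpen hbG
    rw [mem_ball, dist_comm] at hwG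
    exact (hmin w hw).not_gt hwG
  have hseg : Disjoint G (segment ℝ a b) := by
    refine disjoint_left.2 fun w hw hws => ?_
    have h1 := hmin w hw
    have h2 := dist_add_dist_of_mem_segment hws
    have h3 : dist w b = 0 := le_antisymm (by linarith) dist_nonneg
    exact hbG (dist_eq_zero.1 h3 ▸ hw)
  refine isExactOn_inv_sub_of_segment hseg ?_
  have hGD := hG.ssubset_disk.subset
  rcases le_or_gt 1 ‖b‖ with hb1 | hb1
  · exact isExactOn_inv_sub_of_one_le_norm hGD hb1
  · have hbf : b ∈ frontier G := by
      rw [frontier, hG.isOpen.interior_eq]; exact ⟨hb, hbG⟩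
    obtain ⟨H, ⟨ζ, r, hζ, hr, -, rfl⟩, hbH, hGH⟩ :=
      hG.exists_horodisk b ⟨by simpa using hb1, hbf⟩
    have hd := disjoint_closedBall_of_isHorodisk hr hG.isOpen hGH
    refine isExactOn_inv_sub_of_segment (b := ζ) (hd.mono_right ?_)
      (isExactOn_inv_sub_of_one_le_norm hGD hζ.ge)
    refine (convex_closedBall _ _).segment_subset ?_ (mem_closedBall_horodisk hζ hr)
    rw [frontier_ball _ hr.ne'] at hbH
    exact sphere_subset_closedBall hbH

lemma IsHoroConvex.exists_bijOn_ball (hG : IsHoroConvex G) {z : ℂ} (hz : z ∈ G) :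
    ∃ f : ℂ → ℂ, DifferentiableOn ℂ f G ∧ BijOn f G (ball 0 1) ∧ f z = 0 :=
  HoroConvex.exists_bijOn_ball hG.isOpen hG.isConnected hG.ssubset_disk.subset
    (fun _ hf h0 => exists_sq_eq_of_isExactOn hG.isOpen hG.isConnected
      (fun _ hF => isExactOn_of_forall_notMem hG.isOpen hG.isConnected
        (isBounded_ball.subset hG.ssubset_disk.subset)
        (fun _ ha => hG.isExactOn_inv_sub ha) hF) hf h0) hz

/-- The Cayley transform, which maps the unit disk to the right half-plane and `ζ` to infinity. -/
def cayley (ζ w : ℂ) : ℂ := (ζ + w) / (ζ - w)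

section Cayley

variable {ζ w : ℂ}

lemma sub_ne_zero_of_norm_lt (hζ : ‖ζ‖ = 1) (hw : ‖w‖ < 1) : ζ - w ≠ 0 :=
  sub_ne_zero.2 fun h => by rw [← h] at hw; linarith

lemma cayley_re (hζ : ‖ζ‖ = 1) : (cayley ζ w).re = (1 - ‖w‖ ^ 2) / ‖ζ - w‖ ^ 2 := by
  have h1 : ζ.re * ζ.re + ζ.im * ζ.im = 1 := by
    rw [← Complex.normSq_apply, Complex.normSq_eq_norm_sq, hζ, one_pow]
  rw [cayley, Complex.div_re, ← Complex.normSq_eq_norm_sq w, ← Complex.normSq_eq_norm_sq (ζ - w),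
    ← add_div]
  congr 1
  simp [Complex.normSq_apply]
  linear_combination h1

lemma cayley_re_pos (hζ : ‖ζ‖ = 1) (hw : ‖w‖ < 1) : 0 < (cayley ζ w).re := by
  rw [cayley_re hζ]
  have := norm_pos_iff.2 (sub_ne_zero_of_norm_lt hζ hw)
  have : 0 < 1 - ‖w‖ ^ 2 := by nlinarith [norm_nonneg w]
  positivity

/-- The quantity that compares a point with the horocycle of radius `r` at `ζ`. -/
lemma dist_horodisk_sq_sub (hζ : ‖ζ‖ = 1) (r : ℝ) :
    dist w ((1 - r : ℝ) * ζ) ^ 2 - r ^ 2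
      = (1 - r) * ‖ζ - w‖ ^ 2 - r * (1 - ‖w‖ ^ 2) := by
  have h1 : ζ.re * ζ.re + ζ.im * ζ.im = 1 := by
    rw [← Complex.normSq_apply, Complex.normSq_eq_norm_sq, hζ, one_pow]
  rw [dist_eq_norm, ← Complex.normSq_eq_norm_sq, ← Complex.normSq_eq_norm_sq,
    ← Complex.normSq_eq_norm_sq]
  simp [Complex.normSq_apply]
  linear_combination ((1 - r) ^ 2 - (1 - r)) * h1

/-- The Cayley transform takes horodisks at `ζ` to half-planes. -/
lemma mem_closedBall_horodisk_iff (hζ : ‖ζ‖ = 1) {r : ℝ} (hr : 0 < r) (hw : ‖w‖ < 1) :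
    w ∈ closedBall ((1 - r : ℝ) * ζ) r ↔ (1 - r) / r ≤ (cayley ζ w).re := by
  have h0 := norm_pos_iff.2 (sub_ne_zero_of_norm_lt hζ hw)
  rw [cayley_re hζ, div_le_div_iff₀ hr (by positivity), mem_closedBall,
    ← sq_le_sq₀ dist_nonneg hr.le]
  have := dist_horodisk_sq_sub hζ (w := w) r
  constructor <;> intro h <;> nlinarith

lemma mem_ball_horodisk_iff (hζ : ‖ζ‖ = 1) {r : ℝ} (hr : 0 < r) (hw : ‖w‖ < 1) :
    w ∈ ball ((1 - r : ℝ) * ζ) r ↔ (1 - r) / r < (cayley ζ w).re := by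
  have h0 := norm_pos_iff.2 (sub_ne_zero_of_norm_lt hζ hw)
  rw [cayley_re hζ, div_lt_div_iff₀ hr (by positivity), mem_ball,
    ← sq_lt_sq₀ dist_nonneg hr.le]
  have := dist_horodisk_sq_sub hζ (w := w) r
  constructor <;> intro h <;> nlinarith

/-- The inverse of the Cayley transform. -/
def cayleyInv (ζ u : ℂ) : ℂ := ζ * ((u - 1) / (u + 1))

lemma add_one_ne_zero {u : ℂ} (hu : 0 < u.re) : u + 1 ≠ 0 := fun h => by
  have := congrArg Complex.re h
  simp at this
  linarith

lemma cayleyInv_cayley (hζ : ‖ζ‖ = 1) (hw : ‖w‖ < 1) : cayleyInv ζ (cayley ζ w) = w := by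
  have h0 := sub_ne_zero_of_norm_lt hζ hw
  have hζ0 : ζ ≠ 0 := norm_pos_iff.1 (by rw [hζ]; exact one_pos)
  have h1 : cayley ζ w - 1 = 2 * w / (ζ - w) := by rw [cayley]; field_simp; ring
  have h2 : cayley ζ w + 1 = 2 * ζ / (ζ - w) := by rw [cayley]; field_simp; ring
  rw [cayleyInv, h1, h2]
  field_simp

lemma cayley_cayleyInv (hζ : ‖ζ‖ = 1) {u : ℂ} (hu : 0 < u.re) :
    cayley ζ (cayleyInv ζ u) = u := by
  have hζ0 : ζ ≠ 0 := norm_pos_iff.1 (by rw [hζ]; exact one_pos)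
  have h0 := add_one_ne_zero hu
  have h1 : ζ + cayleyInv ζ u = 2 * ζ * u / (u + 1) := by rw [cayleyInv]; field_simp; ring
  have h2 : ζ - cayleyInv ζ u = 2 * ζ / (u + 1) := by rw [cayleyInv]; field_simp; ring
  rw [cayley, h1, h2]
  field_simp

lemma norm_cayleyInv_lt (hζ : ‖ζ‖ = 1) {u : ℂ} (hu : 0 < u.re) : ‖cayleyInv ζ u‖ < 1 := by
  have h0 := add_one_ne_zero hu
  rw [cayleyInv, norm_mul, hζ, one_mul, norm_div, div_lt_one (norm_pos_iff.2 h0),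
    ← sq_lt_sq₀ (norm_nonneg _) (norm_nonneg _), ← Complex.normSq_eq_norm_sq,
    ← Complex.normSq_eq_norm_sq]
  simp [Complex.normSq_apply]
  nlinarith

lemma hasDerivAt_cayley (h0 : ζ - w ≠ 0) : HasDerivAt (cayley ζ) (2 * ζ / (ζ - w) ^ 2) w := by
  refine (((hasDerivAt_id w).const_add ζ).div ((hasDerivAt_id w).const_sub ζ) h0).congr_deriv ?_
  simp only [id]
  congr 1
  ring

/-- The Cayley transform takes horo-crescents to strips. -/
lemma bijOn_cayley (hζ : ‖ζ‖ = 1) (k : ℝ) :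
    BijOn (cayley ζ) {w | ‖w‖ < 1 ∧ (cayley ζ w).re < k} {u | 0 < u.re ∧ u.re < k} := by
  refine InvOn.bijOn (f' := cayleyInv ζ) ⟨fun w hw => cayleyInv_cayley hζ hw.1,
    fun u hu => cayley_cayleyInv hζ hu.1⟩ (fun w hw => ⟨cayley_re_pos hζ hw.1, hw.2⟩)
    fun u hu => ⟨norm_cayleyInv_lt hζ hu.1, ?_⟩
  rw [cayley_cayleyInv hζ hu.1]
  exact hu.2

lemma bijOn_exp_strip {k : ℝ} (hk : 0 < k) :
    BijOn (fun u : ℂ => Complex.exp ((Real.pi / k : ℝ) * u * Complex.I))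
      {u | 0 < u.re ∧ u.re < k} {v | 0 < v.im} := by
  have hpk : 0 < Real.pi / k := div_pos Real.pi_pos hk
  have him : ∀ u : ℂ, ((Real.pi / k : ℝ) * u * Complex.I).im = Real.pi / k * u.re := by
    intro u
    rw [Complex.mul_I_im, Complex.re_ofReal_mul]
  have hrange : ∀ u : ℂ, 0 < u.re ∧ u.re < k →
      0 < Real.pi / k * u.re ∧ Real.pi / k * u.re < Real.pi := by
    rintro u ⟨h1, h2⟩
    refine ⟨by positivity, ?_⟩
    calc Real.pi / k * u.re < Real.pi / k * k := by gcongr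
      _ = Real.pi := by field_simp
  refine ⟨fun u hu => ?_, fun u hu v hv huv => ?_, fun v hv => ?_⟩
  · have h := hrange u hu
    change 0 < (Complex.exp _).im
    rw [Complex.exp_im, him]
    exact mul_pos (Real.exp_pos _) (Real.sin_pos_of_pos_of_lt_pi h.1 h.2)
  · have h1 := hrange u hu
    have h2 := hrange v hv
    have h3 := Complex.exp_inj_of_neg_pi_lt_of_le_pi (by rw [him]; linarith [Real.pi_pos])
      (by rw [him]; exact h1.2.le) (by rw [him]; linarith [Real.pi_pos])
      (by rw [him]; exact h2.2.le) huv
    exact mul_left_cancel₀ (by exact_mod_cast hpk.ne') (mul_right_cancel₀ Complex.I_ne_zero h3)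
  · have hv' : 0 < v.im := hv
    have hv0 : v ≠ 0 := fun h => by rw [h] at hv'; simp at hv'
    have harg0 : 0 < v.arg := lt_of_le_of_ne (Complex.arg_nonneg_iff.2 hv'.le) fun h =>
      hv'.ne' (Complex.arg_eq_zero_iff.1 h.symm).2
    have hargpi : v.arg < Real.pi := lt_of_le_of_ne (Complex.arg_le_pi v) fun h =>
      hv'.ne' (Complex.arg_eq_pi_iff.1 h).2
    have hre : (((k / Real.pi : ℝ) : ℂ) * (-(Complex.log v * Complex.I))).re
        = k / Real.pi * v.arg := by
      rw [Complex.re_ofReal_mul, Complex.neg_re, Complex.mul_I_re, Complex.log_im, neg_neg]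
    refine ⟨(k / Real.pi : ℝ) * (-(Complex.log v * Complex.I)), ⟨?_, ?_⟩, ?_⟩
    · rw [hre]; have := Real.pi_pos; positivity
    · rw [hre]
      calc k / Real.pi * v.arg < k / Real.pi * Real.pi := by
            have := Real.pi_pos; gcongr
        _ = k := by have := Real.pi_ne_zero; field_simp
    · have hk' : (k : ℂ) ≠ 0 := by exact_mod_cast hk.ne'
      have hpi : (Real.pi : ℂ) ≠ 0 := by exact_mod_cast Real.pi_ne_zero
      have : ((Real.pi / k : ℝ) : ℂ) * ((k / Real.pi : ℝ) * (-(Complex.log v * Complex.I)))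
          * Complex.I = Complex.log v := by
        push_cast
        field_simp
        rw [Complex.I_sq]; ring
      beta_reduce
      rw [this, Complex.exp_log hv0]

lemma sub_conj_ne_zero {v v₀ : ℂ} (hv : 0 < v.im) (hv₀ : 0 < v₀.im) :
    v - (starRingEnd ℂ) v₀ ≠ 0 := fun h => by
  have := congrArg Complex.im h
  simp at this
  linarith

lemma bijOn_halfPlane {v₀ : ℂ} (hv₀ : 0 < v₀.im) :
    BijOn (fun v : ℂ => (v - v₀) / (v - (starRingEnd ℂ) v₀)) {v | 0 < v.im} (ball 0 1) := by
  have h00 := sub_conj_ne_zero hv₀ hv₀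
  refine InvOn.bijOn (f' := fun m => (v₀ - (starRingEnd ℂ) v₀ * m) / (1 - m))
    ⟨fun v hv => ?_, fun m hm => ?_⟩ (fun v hv => ?_) (fun m hm => ?_)
  · have h0 := sub_conj_ne_zero hv hv₀
    have h1 : 1 - (v - v₀) / (v - (starRingEnd ℂ) v₀)
        = (v₀ - (starRingEnd ℂ) v₀) / (v - (starRingEnd ℂ) v₀) := by field_simp; ring
    have h2 : v₀ - (starRingEnd ℂ) v₀ * ((v - v₀) / (v - (starRingEnd ℂ) v₀))
        = v * (v₀ - (starRingEnd ℂ) v₀) / (v - (starRingEnd ℂ) v₀) := by field_simp; ring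
    beta_reduce
    rw [h1, h2]
    field_simp
  · have hm1 : 1 - m ≠ 0 := sub_ne_zero.2 fun h => by
      rw [← h] at hm; simp at hm
    have h1 : (v₀ - (starRingEnd ℂ) v₀ * m) / (1 - m) - v₀
        = m * (v₀ - (starRingEnd ℂ) v₀) / (1 - m) := by field_simp; ring
    have h2 : (v₀ - (starRingEnd ℂ) v₀ * m) / (1 - m) - (starRingEnd ℂ) v₀
        = (v₀ - (starRingEnd ℂ) v₀) / (1 - m) := by field_simp; ring
    beta_reduce
    rw [h1, h2]
    field_simp
  · have hv' : 0 < v.im := hv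
    have h0 := sub_conj_ne_zero hv' hv₀
    rw [mem_ball_zero_iff, norm_div, div_lt_one (norm_pos_iff.2 h0),
      ← sq_lt_sq₀ (norm_nonneg _) (norm_nonneg _), ← Complex.normSq_eq_norm_sq,
      ← Complex.normSq_eq_norm_sq]
    simp [Complex.normSq_apply]
    nlinarith [mul_pos hv' hv₀]
  · have hm1 : 1 - m ≠ 0 := sub_ne_zero.2 fun h => by
      rw [← h] at hm; simp at hm
    have hm' : ‖m‖ < 1 := by simpa using hm
    have h1 : ((v₀ - (starRingEnd ℂ) v₀ * m) / (1 - m)).im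
        = v₀.im * (1 - Complex.normSq m) / Complex.normSq (1 - m) := by
      rw [Complex.div_im, ← sub_div]
      congr 1
      simp [Complex.normSq_apply]
      ring
    change 0 < Complex.im _
    rw [h1]
    have h2 : 0 < 1 - Complex.normSq m := by
      rw [Complex.normSq_eq_norm_sq]; nlinarith [norm_nonneg m]
    have h3 := Complex.normSq_pos.2 hm1
    positivity

/-- The conformal map of a horo-crescent onto the unit disk, and its derivative. The crescent is
mapped to a strip, to the upper half-plane and to the disk. -/
lemma exists_bijOn_ball_horoCrescent (hζ : ‖ζ‖ = 1) {k : ℝ} (hk : 0 < k) {z : ℂ} (hz : ‖z‖ < 1)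
    (hzk : (cayley ζ z).re < k) :
    ∃ f : ℂ → ℂ, DifferentiableOn ℂ f {w | ‖w‖ < 1 ∧ (cayley ζ w).re < k} ∧
      BijOn f {w | ‖w‖ < 1 ∧ (cayley ζ w).re < k} (ball 0 1) ∧ f z = 0 ∧
      ‖deriv f z‖ * (1 - ‖z‖ ^ 2) = Real.pi * ((cayley ζ z).re / k) /
        Real.sin (Real.pi * ((cayley ζ z).re / k)) := by
  set C := {w | ‖w‖ < 1 ∧ (cayley ζ w).re < k}
  have hzC : z ∈ C := ⟨hz, hzk⟩
  set E : ℂ → ℂ := fun u => Complex.exp ((Real.pi / k : ℝ) * u * Complex.I)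
  set v₀ := E (cayley ζ z)
  have hbE : BijOn (E ∘ cayley ζ) C {v | 0 < v.im} :=
    (bijOn_exp_strip hk).comp (bijOn_cayley hζ k)
  have hv₀ : 0 < v₀.im := hbE.mapsTo hzC
  have hdE : ∀ w ∈ C, HasDerivAt (E ∘ cayley ζ)
      (E (cayley ζ w) * ((Real.pi / k : ℝ) * (2 * ζ / (ζ - w) ^ 2) * Complex.I)) w := by
    intro w hw
    exact (((hasDerivAt_cayley (sub_ne_zero_of_norm_lt hζ hw.1)).const_mul
      ((Real.pi / k : ℝ) : ℂ)).mul_const Complex.I).cexp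
  have hdM : ∀ v : ℂ, 0 < v.im → HasDerivAt (fun v : ℂ => (v - v₀) / (v - (starRingEnd ℂ) v₀))
      ((v₀ - (starRingEnd ℂ) v₀) / (v - (starRingEnd ℂ) v₀) ^ 2) v := by
    intro v hv
    refine (((hasDerivAt_id v).sub_const _).div ((hasDerivAt_id v).sub_const _)
      (sub_conj_ne_zero hv hv₀)).congr_deriv ?_
    simp only [id]
    congr 1
    ring
  have hd : ∀ w ∈ C, HasDerivAt ((fun v : ℂ => (v - v₀) / (v - (starRingEnd ℂ) v₀)) ∘
      (E ∘ cayley ζ)) _ w := fun w hw => (hdM _ (hbE.mapsTo hw)).comp w (hdE w hw)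
  refine ⟨_, fun w hw => (hd w hw).differentiableAt.differentiableWithinAt,
    (bijOn_halfPlane hv₀).comp hbE, by simp [v₀], ?_⟩
  have h0 := sub_ne_zero_of_norm_lt hζ hz
  have hn0 := norm_pos_iff.2 h0
  have hv₀0 : 0 < ‖v₀‖ := norm_pos_iff.2 (Complex.exp_ne_zero _)
  have hv₀im : v₀.im = ‖v₀‖ * Real.sin (Real.pi * ((cayley ζ z).re / k)) := by
    simp only [v₀, E]
    rw [Complex.exp_im, Complex.norm_exp, Complex.mul_I_im, Complex.re_ofReal_mul]
    congr 2
    ring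
  have hsin : 0 < Real.sin (Real.pi * ((cayley ζ z).re / k)) := by
    rw [hv₀im] at hv₀
    exact pos_of_mul_pos_right hv₀ hv₀0.le
  have hsub : v₀ - (starRingEnd ℂ) v₀ = ((2 * v₀.im : ℝ) : ℂ) * Complex.I := by
    apply Complex.ext <;> simp; ring
  have hre := cayley_re hζ (w := z)
  rw [(hd z hzC).deriv]
  simp only [Function.comp_apply]
  change ‖(v₀ - (starRingEnd ℂ) v₀) / (v₀ - (starRingEnd ℂ) v₀) ^ 2 *
    (v₀ * ((Real.pi / k : ℝ) * (2 * ζ / (ζ - z) ^ 2) * Complex.I))‖ * _ = _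
  rw [hsub]
  simp only [norm_mul, norm_div, norm_pow, Complex.norm_I, Complex.norm_real, hζ, mul_one]
  rw [Real.norm_of_nonneg hv₀.le, Real.norm_of_nonneg Real.pi_pos.le, Real.norm_of_nonneg hk.le,
    Complex.norm_two, Real.norm_two]
  have h1 : 1 - ‖z‖ ^ 2 = (cayley ζ z).re * ‖ζ - z‖ ^ 2 := by
    rw [hre]; field_simp
  rw [h1]
  rw [hv₀im]
  field_simp

end Cayley

section Distance

variable {z w ζ : ℂ}

/-- The pseudo-hyperbolic distance in the half-plane model. -/
lemma pseudoHypDist_eq_cayley (hζ : ‖ζ‖ = 1) (hz : ‖z‖ < 1) (hw : ‖w‖ < 1) :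
    pseudoHypDist z w = ‖cayley ζ z - cayley ζ w‖ /
      ‖cayley ζ z + (starRingEnd ℂ) (cayley ζ w)‖ := by
  have hz0 := sub_ne_zero_of_norm_lt hζ hz
  have hw0 := sub_ne_zero_of_norm_lt hζ hw
  have hw0' : (starRingEnd ℂ) ζ - (starRingEnd ℂ) w ≠ 0 := by
    rw [← map_sub]; exact (map_ne_zero _).2 hw0
  have hζζ : ζ * (starRingEnd ℂ) ζ = 1 := by rw [Complex.mul_conj', hζ]; simp
  have h1 : cayley ζ z - cayley ζ w = 2 * ζ * (z - w) / ((ζ - z) * (ζ - w)) := by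
    rw [cayley, cayley]; field_simp; ring
  have h2 : cayley ζ z + (starRingEnd ℂ) (cayley ζ w)
      = 2 * (1 - z * (starRingEnd ℂ) w) / ((ζ - z) * (starRingEnd ℂ) (ζ - w)) := by
    rw [cayley, cayley, map_div₀, map_add, map_sub, div_add_div _ _ hz0 hw0']
    congr 1
    linear_combination 2 * hζζ
  have h3 : ‖1 - z * (starRingEnd ℂ) w‖ = ‖1 - (starRingEnd ℂ) z * w‖ := by
    rw [← Complex.norm_conj]; simp
  have h4 := norm_pos_iff.2 hz0
  have h5 := norm_pos_iff.2 hw0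
  have h6 := norm_pos_iff.2 (one_sub_conj_mul_ne_zero hz hw.le)
  rw [h1, h2, pseudoHypDist]
  simp only [norm_mul, norm_div, Complex.norm_conj, h3, hζ]
  rw [show ‖(2 : ℂ)‖ = 2 by simp]
  field_simp

lemma pseudoHypDist_nonneg (z w : ℂ) : 0 ≤ pseudoHypDist z w := norm_nonneg _

lemma pseudoHypDist_lt_one (hz : ‖z‖ < 1) (hw : ‖w‖ < 1) : pseudoHypDist z w < 1 := by
  have := norm_diskAut_lt_one hz hw
  rwa [diskAut, norm_div, norm_sub_rev, ← norm_div] at this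

lemma exp_two_mul_hypDist (hz : ‖z‖ < 1) (hw : ‖w‖ < 1) :
    Real.exp (2 * hypDist z w) = (1 + pseudoHypDist z w) / (1 - pseudoHypDist z w) := by
  have h1 := pseudoHypDist_nonneg z w
  have h2 := pseudoHypDist_lt_one hz hw
  rw [hypDist, Real.artanh_eq_half_log ⟨by linarith, h2.le⟩, ← mul_assoc]
  norm_num
  exact Real.exp_log (div_pos (by linarith) (by linarith))

/-- In the half-plane model, the hyperbolic distance of two points is at least that of their
projections to the real axis. -/
lemma cayley_re_div_le_exp (hζ : ‖ζ‖ = 1) (hz : ‖z‖ < 1) (hw : ‖w‖ < 1)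
    (h : (cayley ζ z).re < (cayley ζ w).re) :
    (cayley ζ w).re / (cayley ζ z).re ≤ Real.exp (2 * hypDist z w) := by
  have hx := cayley_re_pos hζ hz
  have hk := cayley_re_pos hζ hw
  have h2 := pseudoHypDist_lt_one hz hw
  rw [exp_two_mul_hypDist hz hw, div_le_div_iff₀ hx (by linarith)]
  have key : ((cayley ζ w).re - (cayley ζ z).re) / ((cayley ζ w).re + (cayley ζ z).re)
      ≤ pseudoHypDist z w := by
    rw [← sq_le_sq₀ (div_nonneg (by linarith) (by linarith)) (pseudoHypDist_nonneg z w),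
      pseudoHypDist_eq_cayley hζ hz hw, div_pow, div_pow, ← Complex.normSq_eq_norm_sq,
      ← Complex.normSq_eq_norm_sq]
    set u := cayley ζ z
    set v := cayley ζ w
    have e1 : Complex.normSq (u - v) = (v.re - u.re) ^ 2 + (u.im - v.im) ^ 2 := by
      simp [Complex.normSq_apply]; ring
    have e2 : Complex.normSq (u + (starRingEnd ℂ) v) = (v.re + u.re) ^ 2 + (u.im - v.im) ^ 2 := by
      simp [Complex.normSq_apply]; ring
    rw [e1, e2, div_le_div_iff₀ (by positivity) (by positivity)]
    nlinarith [mul_nonneg (mul_pos hx hk).le (sq_nonneg (u.im - v.im))]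
  rw [div_le_iff₀ (by linarith)] at key
  nlinarith

lemma exp_two_mul_hypDist_of_im_eq (hζ : ‖ζ‖ = 1) (hz : ‖z‖ < 1) (hw : ‖w‖ < 1)
    (h : (cayley ζ z).re < (cayley ζ w).re) (him : (cayley ζ z).im = (cayley ζ w).im) :
    Real.exp (2 * hypDist z w) = (cayley ζ w).re / (cayley ζ z).re := by
  have hx := cayley_re_pos hζ hz
  have hk := cayley_re_pos hζ hw
  have key : pseudoHypDist z w
      = ((cayley ζ w).re - (cayley ζ z).re) / ((cayley ζ w).re + (cayley ζ z).re) := by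
    rw [pseudoHypDist_eq_cayley hζ hz hw]
    set u := cayley ζ z
    set v := cayley ζ w
    have e1 : u - v = ((u.re - v.re : ℝ) : ℂ) := by apply Complex.ext <;> simp [him]
    have e2 : u + (starRingEnd ℂ) v = ((v.re + u.re : ℝ) : ℂ) := by
      apply Complex.ext <;> simp [him]; ring
    rw [e1, e2, Complex.norm_real, Complex.norm_real, Real.norm_of_nonpos (by linarith),
      Real.norm_of_nonneg (by linarith), neg_sub]
  set x := (cayley ζ z).re
  set k := (cayley ζ w).re
  have e1 : 1 + (k - x) / (k + x) = 2 * k / (k + x) := by field_simp; ring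
  have e2 : 1 - (k - x) / (k + x) = 2 * x / (k + x) := by field_simp; ring
  rw [exp_two_mul_hypDist hz hw, key, e1, e2]
  field_simp

end Distance

end

/-! ### The hyperbolic density -/

section

open Filter Topology

section HypMetric

variable {G C : Set ℂ} {f : ℂ → ℂ}

/-- The inverse of a conformal map onto the unit disk is a holomorphic covering. -/
lemma isHolomorphicCovering_invFunOn (hG : IsOpen G) (hf : DifferentiableOn ℂ f G)
    (hb : BijOn f G (ball 0 1)) : IsHolomorphicCovering (Function.invFunOn f G) G := by
  set p := Function.invFunOn f G
  have hpf : ∀ w ∈ G, p (f w) = w := fun w hw => hb.injOn.leftInvOn_invFunOn hw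
  have hfp : ∀ z ∈ ball (0 : ℂ) 1, f (p z) = z := fun z hz => hb.surjOn.rightInvOn_invFunOn hz
  have hpm : ∀ z ∈ ball (0 : ℂ) 1, p z ∈ G := fun z hz => hb.surjOn.mapsTo_invFunOn hz
  have hpd : DifferentiableOn ℂ p (ball 0 1) := by
    intro z hz
    have := analyticAt_leftInverse_of_injOn hG hf hb.injOn hpf (hpm z hz)
    rw [hfp z hz] at this
    exact this.differentiableAt.differentiableWithinAt
  refine ⟨hpd, ?_, ?_⟩
  · refine Subset.antisymm (image_subset_iff.2 hpm) fun w hw => ⟨f w, hb.mapsTo hw, hpf w hw⟩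
  · let e : ball (0 : ℂ) 1 ≃ₜ G :=
      { toFun := fun z => ⟨p z, hpm z z.2⟩
        invFun := fun w => ⟨f w, hb.mapsTo w.2⟩
        left_inv := fun z => Subtype.ext (hfp z z.2)
        right_inv := fun w => Subtype.ext (hpf w w.2)
        continuous_toFun := hpd.continuousOn.mapsToRestrict hpm
        continuous_invFun := hf.continuousOn.mapsToRestrict hb.mapsTo }
    have huniv : (fun z : ball (0 : ℂ) 1 => p z) ⁻¹' G = univ :=
      eq_univ_of_forall fun z => hpm z z.2
    intro w hw
    refine IsEvenlyCovered.to_isEvenlyCovered_preimage (I := Unit)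
      ⟨inferInstance, G, hw, hG, by rw [huniv]; exact isOpen_univ,
        (Homeomorph.setCongr huniv).trans ((Homeomorph.Set.univ _).trans
          (e.trans (Homeomorph.prodPUnit _).symm)), fun z => rfl⟩

/-- The hyperbolic metric is not a junk value if there is a conformal map onto the disk. -/
lemma exists_isHypMetricAt (hG : IsOpen G) (hf : DifferentiableOn ℂ f G)
    (hb : BijOn f G (ball 0 1)) {z : ℂ} (hz : z ∈ G) : ∃ t, IsHypMetricAt G z t := by
  set p := Function.invFunOn f G
  have hpf : ∀ w ∈ G, p (f w) = w := fun w hw => hb.injOn.leftInvOn_invFunOn hw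
  have h1 := deriv_mul_deriv_leftInverse hG hf hb.injOn hpf hz
  have h2 : ‖deriv p (f z)‖ ≠ 0 := norm_ne_zero_iff.2 (left_ne_zero_of_mul_eq_one h1)
  exact ⟨diskMetric (f z) / ‖deriv p (f z)‖, p, f z, isHolomorphicCovering_invFunOn hG hf hb,
    hb.mapsTo hz, hpf z hz, div_mul_cancel₀ _ h2⟩

lemma isHypMetricAt_hypMetric {z : ℂ} (h : ∃ t, IsHypMetricAt G z t) :
    IsHypMetricAt G z (hypMetric G z) := by
  rw [hypMetric, dif_pos h]
  exact h.choose_spec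

/-- Monotonicity of the hyperbolic metric, with its equality case. -/
lemma IsHypMetricAt.norm_deriv_le (hC : IsOpen C) (hf : DifferentiableOn ℂ f C)
    (hb : BijOn f C (ball 0 1)) (hGC : G ⊆ C) {z : ℂ} (hfz : f z = 0) {t : ℝ}
    (ht : IsHypMetricAt G z t) : ‖deriv f z‖ ≤ t ∧ (t = ‖deriv f z‖ → G = C) := by
  obtain ⟨p, a, hp, ha, rfl, hta⟩ := ht
  have hpm : MapsTo p (ball 0 1) G := mapsTo_iff_image_subset.2 hp.image_eq.subset
  have hpC : MapsTo p (ball 0 1) C := hpm.mono_right hGC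
  have hs : 0 < 1 - ‖a‖ ^ 2 := by
    have : ‖a‖ < 1 := by simpa using ha
    nlinarith [norm_nonneg a]
  have hder : deriv (f ∘ p) a = deriv f (p a) * deriv p a :=
    deriv_comp a (hf.differentiableAt (hC.mem_nhds (hpC ha)))
      (hp.differentiableOn.differentiableAt (isOpen_ball.mem_nhds ha))
  have hsch := norm_deriv_mul_le_one (hf.comp hp.differentiableOn hpC) (hb.mapsTo.comp hpC) ha hfz
  rw [hder, norm_mul] at hsch
  have hts : t * (‖deriv p a‖ * (1 - ‖a‖ ^ 2)) = 1 := by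
    rw [← mul_assoc, hta, diskMetric, one_div, inv_mul_cancel₀ hs.ne']
  have hpos : 0 < ‖deriv p a‖ * (1 - ‖a‖ ^ 2) := by
    refine lt_of_le_of_ne (by positivity) fun h => ?_
    rw [← h, mul_zero] at hts
    exact zero_ne_one hts
  rw [mul_assoc] at hsch
  refine ⟨le_of_mul_le_mul_right (hsch.1.trans_eq hts.symm) hpos, fun h => Subset.antisymm hGC fun w hw => ?_⟩
  obtain ⟨ζ, hζ, hζw⟩ := (hsch.2 (by rw [← h, hts])).surjOn (hb.mapsTo hw)
  rw [← hb.injOn (hpC hζ) hw hζw]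
  exact hpm hζ

/-- If `C` is mapped conformally onto the disk by `f`, every covering of `C` gives the same
metric as `f`: the inverse of `f` lifts to an inverse of `f ∘ p`. -/
lemma IsHypMetricAt.eq_norm_deriv (hC : IsOpen C) (hf : DifferentiableOn ℂ f C)
    (hb : BijOn f C (ball 0 1)) {z : ℂ} (hfz : f z = 0) {t : ℝ}
    (ht : IsHypMetricAt C z t) : t = ‖deriv f z‖ := by
  have hle := (ht.norm_deriv_le hC hf hb subset_rfl hfz).1
  obtain ⟨p, a, hp, ha, rfl, hta⟩ := ht
  have ha' : ‖a‖ < 1 := by simpa using ha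
  have hpC : MapsTo p (ball 0 1) C := mapsTo_iff_image_subset.2 hp.image_eq.subset
  have hs : 0 < 1 - ‖a‖ ^ 2 := by nlinarith [norm_nonneg a]
  set q := Function.invFunOn f C
  have hq := isHolomorphicCovering_invFunOn hC hf hb
  have hqf : ∀ w ∈ C, q (f w) = w := fun w hw => hb.injOn.leftInvOn_invFunOn hw
  have hfq : ∀ w ∈ ball (0 : ℂ) 1, f (q w) = w := fun w hw => hb.surjOn.rightInvOn_invFunOn hw
  have hqC : ∀ w ∈ ball (0 : ℂ) 1, q w ∈ C := fun w hw => hb.surjOn.mapsTo_invFunOn hw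
  set g := f ∘ p
  have hgm : MapsTo g (ball 0 1) (ball 0 1) := hb.mapsTo.comp hpC
  have hgd : DifferentiableOn ℂ g (ball 0 1) := hf.comp hp.differentiableOn hpC
  have : ContractibleSpace (ball (0 : ℂ) 1) :=
    (convex_ball (0 : ℂ) 1).contractibleSpace ⟨0, mem_ball_self one_pos⟩
  have : LocallyPathConnectedSpace (ball (0 : ℂ) 1) := isOpen_ball.locallyPathConnectedSpace
  let Q : C(ball (0 : ℂ) 1, ℂ) := ⟨fun w => q w, hq.differentiableOn.continuousOn.domRestrict⟩
  let P : C(ball (0 : ℂ) 1, ℂ) := ⟨fun w => p w, hp.differentiableOn.continuousOn.domRestrict⟩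
  let g' : C(ball (0 : ℂ) 1, ball (0 : ℂ) 1) :=
    ⟨fun w => ⟨g w, hgm w.2⟩, hgd.continuousOn.mapsToRestrict hgm⟩
  obtain ⟨F, ⟨hF0, hF⟩, -⟩ := hp.isCoveringMapOn.existsUnique_continuousMap_lifts Q
    (a₀ := ⟨0, mem_ball_self one_pos⟩) (e₀ := ⟨a, ha⟩)
    (by change p a = q 0; rw [← hfz, hqf _ (hpC ha)]) fun w => hqC w w.2
  have hFp : ∀ w, p (F w) = q w := fun w => congrFun hF w
  -- `F ∘ g` and the identity are lifts of `p` that agree at `a`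
  have hFg : F.comp g' = ContinuousMap.id _ := by
    refine (hp.isCoveringMapOn.existsUnique_continuousMap_lifts P (a₀ := ⟨a, ha⟩)
      (e₀ := ⟨a, ha⟩) rfl fun w => hpC w.2).unique ⟨?_, ?_⟩ ⟨rfl, rfl⟩
    · exact (congrArg F (Subtype.ext hfz : g' ⟨a, ha⟩ = ⟨0, mem_ball_self one_pos⟩)).trans hF0
    · ext w
      change p (F (g' w)) = p w
      rw [hFp]
      exact hqf _ (hpC w.2)
  classical
  set h : ℂ → ℂ := fun w => if hw : w ∈ ball (0 : ℂ) 1 then F ⟨w, hw⟩ else 0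
  have hhF : ∀ w (hw : w ∈ ball (0 : ℂ) 1), h w = F ⟨w, hw⟩ := fun w hw => dif_pos hw
  have hhm : MapsTo h (ball 0 1) (ball 0 1) := fun w hw => by
    rw [hhF w hw]; exact (F _).2
  have hhg : ∀ w ∈ ball (0 : ℂ) 1, h (g w) = w := fun w hw => by
    rw [hhF _ (hgm hw)]
    exact congrArg Subtype.val (DFunLike.congr_fun hFg ⟨w, hw⟩)
  have hgh : ∀ w ∈ ball (0 : ℂ) 1, g (h w) = w := fun w hw => by
    rw [hhF w hw]
    change f (p (F ⟨w, hw⟩)) = w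
    rw [hFp]
    exact hfq w hw
  have hgi : InjOn g (ball 0 1) := fun v hv w hw hvw => by rw [← hhg v hv, hvw, hhg w hw]
  have hhd : DifferentiableOn ℂ h (ball 0 1) := by
    intro w hw
    have := analyticAt_leftInverse_of_injOn isOpen_ball hgd hgi hhg (hhm hw)
    rw [hgh w hw] at this
    exact this.differentiableAt.differentiableWithinAt
  have hga : g a = 0 := hfz
  have hh0 : h 0 = a := by rw [← hga, hhg a ha]
  have hder := deriv_mul_deriv_leftInverse isOpen_ball hgd hgi hhg ha
  rw [hga] at hder
  have h1 := (norm_deriv_mul_le_one ((differentiableOn_diskAut ha').comp hhd hhm)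
    ((diskAut_mapsTo ha').comp hhm) (mem_ball_self one_pos)
    (by rw [Function.comp_apply, hh0, diskAut_self])).1
  have h2 : HasDerivAt (diskAut a ∘ h)
      ((1 - ‖a‖ ^ 2 : ℝ) / (1 - (starRingEnd ℂ) a * a) ^ 2 * deriv h 0) 0 := by
    have h3 : HasDerivAt (diskAut a) ((1 - ‖a‖ ^ 2 : ℝ) / (1 - (starRingEnd ℂ) a * a) ^ 2)
        (h 0) := by
      rw [hh0]; exact hasDerivAt_diskAut ha' ha'
    exact h3.comp 0 (hhd.differentiableAt (ball_mem_nhds 0 one_pos)).hasDerivAt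
  have h4 : (1 - (starRingEnd ℂ) a * a) = ((1 - ‖a‖ ^ 2 : ℝ) : ℂ) := by
    rw [Complex.conj_mul']; push_cast; rfl
  rw [h2.deriv, h4, norm_mul, norm_div, norm_pow, Complex.norm_real, Real.norm_of_nonneg hs.le,
    norm_zero, zero_pow two_ne_zero, sub_zero, mul_one] at h1
  have h5 : ‖deriv h 0‖ ≤ 1 - ‖a‖ ^ 2 := by
    have : (1 - ‖a‖ ^ 2) / (1 - ‖a‖ ^ 2) ^ 2 * ‖deriv h 0‖ = ‖deriv h 0‖ / (1 - ‖a‖ ^ 2) := by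
      field_simp
    rwa [this, div_le_one hs] at h1
  have h6 : ‖deriv h 0‖ * ‖deriv g a‖ = 1 := by rw [← norm_mul, hder, norm_one]
  have h7 : deriv g a = deriv f (p a) * deriv p a :=
    deriv_comp a (hf.differentiableAt (hC.mem_nhds (hpC ha)))
      (hp.differentiableOn.differentiableAt (isOpen_ball.mem_nhds ha))
  rw [h7, norm_mul] at h6
  have hts : t * ‖deriv p a‖ * (1 - ‖a‖ ^ 2) = 1 := by
    rw [hta, diskMetric, one_div, inv_mul_cancel₀ hs.ne']
  refine le_antisymm ?_ hle
  have hpos : 0 < ‖deriv p a‖ * (1 - ‖a‖ ^ 2) := by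
    refine lt_of_le_of_ne (by positivity) fun h => ?_
    rw [mul_assoc, ← h, mul_zero] at hts
    exact zero_ne_one hts
  refine le_of_mul_le_mul_right ?_ hpos
  calc t * (‖deriv p a‖ * (1 - ‖a‖ ^ 2)) = ‖deriv h 0‖ * (‖deriv f (p a)‖ * ‖deriv p a‖) := by
        rw [← mul_assoc, hts, h6]
    _ ≤ (1 - ‖a‖ ^ 2) * (‖deriv f (p a)‖ * ‖deriv p a‖) := by gcongr
    _ = ‖deriv f (p a)‖ * (‖deriv p a‖ * (1 - ‖a‖ ^ 2)) := by ring

end HypMetric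

variable {G : Set ℂ} {z ζ : ℂ}

/-- The distance to the boundary is attained: the pseudo-hyperbolic distance extends continuously to
the closed disk, with the value `1` on the unit circle, so its minimum over the compact set
`closedBall 0 1 ∩ frontier G` is attained in the open disk. -/
lemma IsHoroConvex.exists_hypDist_eq (hG : IsHoroConvex G) (hz : z ∈ G) :
    ∃ ω ∈ ball (0 : ℂ) 1 ∩ frontier G, hypDist z ω = hypDistBoundary G z ∧
      ∀ ω' ∈ ball (0 : ℂ) 1 ∩ frontier G, hypDistBoundary G z ≤ hypDist z ω' := by
  have hz' : ‖z‖ < 1 := by simpa using hG.ssubset_disk.subset hz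
  obtain ⟨ω₀, hω₀⟩ : (ball (0 : ℂ) 1 ∩ frontier G).Nonempty := by
    obtain ⟨v, hv, hvG⟩ := exists_of_ssubset hG.ssubset_disk
    by_contra hne
    have hsub : ball (0 : ℂ) 1 ⊆ interior G ∪ (closure G)ᶜ := by
      intro w hw
      by_contra h
      rw [mem_union, not_or, mem_compl_iff, not_not] at h
      exact hne ⟨w, hw, h.2, h.1⟩
    have hpre : IsPreconnected (ball (0 : ℂ) 1) := (convex_ball 0 1).isPreconnected
    obtain ⟨w, -, hw1, hw2⟩ := hpre _ _ isOpen_interior isClosed_closure.isOpen_compl hsub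
      ⟨z, hG.ssubset_disk.subset hz, by rwa [hG.isOpen.interior_eq]⟩
      ⟨v, hv, (hsub hv).resolve_left fun h => hvG (interior_subset h)⟩
    exact hw2 (subset_closure (interior_subset hw1))
  have hcont : ContinuousOn (pseudoHypDist z) (closedBall 0 1 ∩ frontier G) := by
    refine ContinuousOn.norm (ContinuousOn.div (by fun_prop) (by fun_prop) fun w hw => ?_)
    exact one_sub_conj_mul_ne_zero hz' (by simpa using hw.1)
  obtain ⟨ω, hω, hmin⟩ := ((isCompact_closedBall (0 : ℂ) 1).inter_right
    isClosed_frontier).exists_isMinOn ⟨ω₀, ball_subset_closedBall hω₀.1, hω₀.2⟩ hcont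
  have hωD : ω ∈ ball (0 : ℂ) 1 := by
    have h1 : pseudoHypDist z ω < 1 :=
      (hmin ⟨ball_subset_closedBall hω₀.1, hω₀.2⟩ :
        pseudoHypDist z ω ≤ pseudoHypDist z ω₀).trans_lt
          (pseudoHypDist_lt_one hz' (by simpa using hω₀.1))
    by_contra hnot
    have hn : ‖ω‖ = 1 := le_antisymm (by simpa using hω.1) (by simpa using hnot)
    have h0 := one_sub_conj_mul_ne_zero hz' hn.le
    rw [pseudoHypDist, norm_div, div_lt_one (norm_pos_iff.2 h0), norm_sub_rev] at h1
    have h2 := norm_one_sub_conj_mul_sq_sub z ω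
    rw [hn] at h2
    nlinarith [norm_nonneg (ω - z)]
  have hle : ∀ ω' ∈ ball (0 : ℂ) 1 ∩ frontier G, hypDist z ω ≤ hypDist z ω' := by
    intro ω' hω'
    have h1 : pseudoHypDist z ω ≤ pseudoHypDist z ω' :=
      hmin ⟨ball_subset_closedBall hω'.1, hω'.2⟩
    have h2 := pseudoHypDist_lt_one hz' (by simpa using hω'.1 : ‖ω'‖ < 1)
    have h3 := pseudoHypDist_nonneg z ω
    exact Real.strictMonoOn_artanh.monotoneOn ⟨by linarith, by linarith⟩
      ⟨by linarith, h2⟩ h1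
  have heq : hypDistBoundary G z = hypDist z ω := by
    refine IsLeast.csInf_eq ⟨mem_image_of_mem _ ⟨hωD, hω.2⟩, ?_⟩
    rintro _ ⟨ω', hω', rfl⟩
    exact hle ω' hω'
  exact ⟨ω, ⟨hωD, hω.2⟩, heq.symm, fun ω' hω' => heq ▸ hle ω' hω'⟩

lemma ball_diff_closure_horodisk (hζ : ‖ζ‖ = 1) {r : ℝ} (hr : 0 < r) :
    ball (0 : ℂ) 1 \ closure (ball ((1 - r : ℝ) * ζ) r)
      = {w | ‖w‖ < 1 ∧ (cayley ζ w).re < (1 - r) / r} := by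
  ext w
  rw [closure_ball _ hr.ne', Set.mem_sdiff, mem_ball_zero_iff, mem_ofPred]
  refine and_congr_right fun hw => ?_
  rw [mem_closedBall_horodisk_iff hζ hr hw, not_le]

lemma cayley_re_eq_of_mem_frontier_horodisk (hζ : ‖ζ‖ = 1) {r : ℝ} (hr : 0 < r) {w : ℂ}
    (hw : ‖w‖ < 1) (h : w ∈ frontier (ball ((1 - r : ℝ) * ζ) r)) :
    (cayley ζ w).re = (1 - r) / r := by
  rw [frontier_ball _ hr.ne'] at h
  refine le_antisymm (not_lt.1 fun h1 => ?_)
    ((mem_closedBall_horodisk_iff hζ hr hw).1 (sphere_subset_closedBall h))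
  have := (mem_ball_horodisk_iff hζ hr hw).2 h1
  rw [mem_ball] at this
  exact this.ne (mem_sphere.1 h)

/-- The distance to the boundary of a horo-crescent. -/
lemma exp_two_mul_hypDistBoundary_horoCrescent {r : ℝ} (hζ : ‖ζ‖ = 1) (hr : 0 < r) (hr1 : r < 1)
    (hG : IsHoroConvex G) (hGC : G = {w | ‖w‖ < 1 ∧ (cayley ζ w).re < (1 - r) / r})
    (hz : z ∈ G) :
    Real.exp (2 * hypDistBoundary G z) = (1 - r) / r / (cayley ζ z).re := by
  set k := (1 - r) / r
  have hk : 0 < k := div_pos (by linarith) hr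
  have hzC := hz
  rw [hGC] at hzC
  obtain ⟨hz1, hzk⟩ : ‖z‖ < 1 ∧ (cayley ζ z).re < k := hzC
  obtain ⟨ω, hω, hωd, hmin⟩ := hG.exists_hypDist_eq hz
  have hω1 : ‖ω‖ < 1 := by simpa using hω.1
  refine le_antisymm ?_ ?_
  -- `ω₁` is the horizontal projection of `z` to the boundary of the strip
  · set c := (cayley ζ z).im
    set ω₁ := cayleyInv ζ (k + c * Complex.I)
    have hre : ∀ s : ℝ, ((s : ℂ) + c * Complex.I).re = s := fun s => by simp
    have hT : ∀ s : ℝ, 0 < s → cayley ζ (cayleyInv ζ (s + c * Complex.I)) = s + c * Complex.I :=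
      fun s hs => cayley_cayleyInv hζ (by rw [hre]; exact hs)
    have hn : ∀ s : ℝ, 0 < s → ‖cayleyInv ζ (s + c * Complex.I)‖ < 1 :=
      fun s hs => norm_cayleyInv_lt hζ (by rw [hre]; exact hs)
    have hfr : ω₁ ∈ frontier G := by
      rw [frontier, hG.isOpen.interior_eq]
      refine ⟨?_, fun h => ?_⟩
      · have hct : ContinuousAt (fun s : ℝ => cayleyInv ζ (s + c * Complex.I)) k := by
          have := add_one_ne_zero (u := (k : ℂ) + c * Complex.I) (by rw [hre]; exact hk)
          unfold cayleyInv
          fun_prop (disch := assumption)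
        refine mem_closure_of_tendsto (hct.tendsto.mono_left
          (nhdsWithin_le_nhds (s := Iio k))) ?_
        filter_upwards [self_mem_nhdsWithin, nhdsWithin_le_nhds (Ioi_mem_nhds hk)] with s hs1 hs2
        rw [hGC]
        exact ⟨hn s hs2, by rw [hT s hs2, hre]; exact hs1⟩
      · rw [hGC] at h
        have h2 := h.2
        rw [hT k hk, hre] at h2
        exact lt_irrefl _ h2
    have h1 := hmin ω₁ ⟨by simpa using hn k hk, hfr⟩
    have h2 := exp_two_mul_hypDist_of_im_eq hζ hz1 (hn k hk)
      (by rw [hT k hk, hre]; exact hzk) (by rw [hT k hk]; simp [c])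
    rw [hT k hk, hre] at h2
    rw [← h2]
    gcongr
  · have hωk : (cayley ζ ω).re = k := by
      apply cayley_re_eq_of_mem_frontier_horodisk hζ hr hω1
      have hG' := hGC
      rw [← ball_diff_closure_horodisk hζ hr] at hG'
      have h1 : ω ∈ closure G ∧ ω ∉ G := by
        have := hω.2
        rwa [frontier, hG.isOpen.interior_eq] at this
      rw [frontier_eq_closure_inter_closure]
      refine ⟨?_, closure_mono ?_ h1.1⟩
      · by_contra h
        exact h1.2 (hG' ▸ ⟨hω.1, h⟩)
      · rw [hG']
        exact fun w hw h => hw.2 (subset_closure h)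
    rw [← hωd, ← hωk]
    exact cayley_re_div_le_exp hζ hz1 hω1 (by rw [hωk]; exact hzk)

lemma div_sin_le_div_sin {s t : ℝ} (hs : 0 < s) (hst : s ≤ t) (ht : t < Real.pi) :
    s / Real.sin s ≤ t / Real.sin t := by
  have ht0 : 0 < t := hs.trans_le hst
  have h1 := Real.sin_pos_of_pos_of_lt_pi hs (hst.trans_lt ht)
  have h2 := Real.sin_pos_of_pos_of_lt_pi ht0 ht
  rw [div_le_div_iff₀ h1 h2]
  have := strictConcaveOn_sin_Icc.concaveOn.2 (left_mem_Icc.2 Real.pi_pos.le) ⟨ht0.le, ht.le⟩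
    (show 0 ≤ 1 - s / t from sub_nonneg.2 ((div_le_one ht0).2 hst))
    (show 0 ≤ s / t by positivity) (by ring)
  simp only [smul_eq_mul, mul_zero, Real.sin_zero, zero_add] at this
  rw [div_mul_cancel₀ _ ht0.ne', div_mul_eq_mul_div, div_le_iff₀ ht0] at this
  linarith

end

end HoroConvex

end

open HoroConvex in
theorem theorem1p2 (G : Set ℂ) (hG : HoroConvex.IsHoroConvex G) (z : ℂ) (hz : z ∈ G) :
    Real.pi / Real.exp (2 * HoroConvex.hypDistBoundary G z) *
        (1 / Real.sin (Real.pi / Real.exp (2 * HoroConvex.hypDistBoundary G z))) ≤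
      HoroConvex.hypDensity G z ∧
    (HoroConvex.hypDensity G z =
        Real.pi / Real.exp (2 * HoroConvex.hypDistBoundary G z) *
          (1 / Real.sin (Real.pi / Real.exp (2 * HoroConvex.hypDistBoundary G z))) ↔
      HoroConvex.IsHoroCrescent G) := by
  have hz1 : ‖z‖ < 1 := by simpa using hG.ssubset_disk.subset hz
  have hs : 0 < 1 - ‖z‖ ^ 2 := by nlinarith [norm_nonneg z]
  obtain ⟨φ, hφd, hφb, -⟩ := hG.exists_bijOn_ball hz
  have ht := isHypMetricAt_hypMetric (exists_isHypMetricAt hG.isOpen hφd hφb hz)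
  have hdens : hypDensity G z = hypMetric G z * (1 - ‖z‖ ^ 2) := by
    rw [hypDensity, diskMetric, one_div, div_inv_eq_mul]
  rw [mul_one_div, hdens]
  have hCo : ∀ (ζ : ℂ) (r : ℝ), ‖ζ‖ = 1 → 0 < r →
      IsOpen {w | ‖w‖ < 1 ∧ (cayley ζ w).re < (1 - r) / r} := fun ζ r hζ hr => by
    rw [← ball_diff_closure_horodisk hζ hr]
    exact isOpen_ball.sdiff isClosed_closure
  obtain ⟨ω, ⟨hωD, hωf⟩, hωd, -⟩ := hG.exists_hypDist_eq hz
  have hω1 : ‖ω‖ < 1 := by simpa using hωD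
  obtain ⟨H, ⟨ζ, r, hζ, hr, hr1, rfl⟩, hωH, hGH⟩ := hG.exists_horodisk ω ⟨hωD, hωf⟩
  have hωk := cayley_re_eq_of_mem_frontier_horodisk hζ hr hω1 hωH
  set k := (1 - r) / r
  have hk : 0 < k := div_pos (by linarith) hr
  set C := {w | ‖w‖ < 1 ∧ (cayley ζ w).re < k}
  have hGC : G ⊆ C := by
    intro w hw
    change w ∈ {w | ‖w‖ < 1 ∧ (cayley ζ w).re < (1 - r) / r}
    rw [← ball_diff_closure_horodisk hζ hr, closure_ball _ hr.ne']
    exact ⟨hG.ssubset_disk.subset hw,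
      disjoint_left.1 (disjoint_closedBall_of_isHorodisk hr hG.isOpen hGH) hw⟩
  have hzk : (cayley ζ z).re < k := (hGC hz).2
  have hx := cayley_re_pos hζ hz1
  obtain ⟨f, hfd, hfb, hfz, hfv⟩ := exists_bijOn_ball_horoCrescent hζ hk hz1 hzk
  have hmono := ht.norm_deriv_le (hCo ζ r hζ hr) hfd hfb hGC hfz
  have hexp : k / (cayley ζ z).re ≤ Real.exp (2 * hypDistBoundary G z) := by
    rw [← hωd, ← hωk]
    exact cayley_re_div_le_exp hζ hz1 hω1 (by rw [hωk]; exact hzk)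
  have hsin : Real.pi / Real.exp (2 * hypDistBoundary G z) /
      Real.sin (Real.pi / Real.exp (2 * hypDistBoundary G z)) ≤ ‖deriv f z‖ * (1 - ‖z‖ ^ 2) := by
    rw [hfv]
    refine div_sin_le_div_sin (by have := Real.pi_pos; positivity) ?_ ?_
    · rw [div_eq_mul_inv]
      refine mul_le_mul_of_nonneg_left ?_ Real.pi_pos.le
      rw [← inv_div]
      exact inv_anti₀ (by positivity) hexp
    · exact mul_lt_of_lt_one_right Real.pi_pos ((div_lt_one hk).2 hzk)
  have hle : ‖deriv f z‖ * (1 - ‖z‖ ^ 2) ≤ hypMetric G z * (1 - ‖z‖ ^ 2) :=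
    mul_le_mul_of_nonneg_right hmono.1 hs.le
  refine ⟨hsin.trans hle, fun h => ?_, ?_⟩
  · refine ⟨_, ⟨ζ, r, hζ, hr, hr1, rfl⟩, ?_⟩
    rw [ball_diff_closure_horodisk hζ hr]
    exact hmono.2 (mul_right_cancel₀ hs.ne' (le_antisymm (h.trans_le hsin) hle))
  · rintro ⟨H', ⟨ζ', r', hζ', hr', hr1', rfl⟩, hG'⟩
    rw [ball_diff_closure_horodisk hζ' hr'] at hG'
    have hk' : 0 < (1 - r') / r' := div_pos (by linarith) hr'
    have hzk' : (cayley ζ' z).re < (1 - r') / r' := (hG' ▸ hz : z ∈ {w | _}).2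
    obtain ⟨f', hfd', hfb', hfz', hfv'⟩ := exists_bijOn_ball_horoCrescent hζ' hk' hz1 hzk'
    rw [← hG'] at hfd' hfb'
    have harg : Real.pi / ((1 - r') / r' / (cayley ζ' z).re)
        = Real.pi * ((cayley ζ' z).re / ((1 - r') / r')) := by
      rw [div_div_eq_mul_div Real.pi, mul_div_assoc]
    rw [ht.eq_norm_deriv hG.isOpen hfd' hfb' hfz', hfv',
      exp_two_mul_hypDistBoundary_horoCrescent hζ' hr' hr1' hG hG' hz, harg]
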